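/- All algebras are associative unital complex algebras. An Arens–Michael algebra is a complete (Hausdorff) locally convex algebra whose topology is generated by a family of submultiplicative seminorms. Let $A$ be an Arens–Michael algebra and $\alpha$ a topological algebra automorphism of $A$ such that $\{\alpha,\alpha^{-1}\}$ is $m$-localizable: the topology of $A$ is generated by some family $\mathcal S$ of submultiplicative seminorms such that for each $T\in\{\alpha,\alpha^{-1}\}$ and each $q\in\mathcal S$ there is $C>0$ with $q(Ta)\le C\,q(a)$ for all $a\in A$. Let $\{\|\cdot\|_\lambda\}_{\lambda\in\Lambda}$ be any family of seminorms generating the topology of $A$, and let $$\mathcal O(\mathbb C^\times,A;\alpha)=\Big\{\sum_{i\in\mathbb Z}a_it^i:\ a_i\in A,\ \Big\|\sum_i a_it^i\Big\|_{\lambda,\rho}:=\sum_{i\in\mathbb Z}\|a_i\|_\lambda\rho^i<\infty\ \ \forall\lambda\in\Lambda,\ 0<\rho<\infty\Big\},$$ with the topology generated by the seminorms $\|\cdot\|_{\lambda,\rho}$ and the multiplication $\big(\sum_i a_it^i\big)\big(\sum_j b_jt^j\big)=\sum_n\big(\sum_i a_i\alpha^i(b_{n-i})\big)t^n$, so that $ta=\alpha(a)t$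 and $t^{-1}a=\alpha^{-1}(a)t^{-1}$ for $a\in A$, and $tt^{-1}=t^{-1}t=1$. Let $A_\alpha$ be the topological $A$-bimodule which is $A$ as a left module and has right action $x\circ a=x\,\alpha(a)$. The bimodules $A_\alpha$ and $A_{\alpha^{-1}}$ are topologically inverse via the isomorphisms $A_\alpha\hat\otimes_A A_{\alpha^{-1}}\cong A$, $x\otimes y\mapsto x\alpha(y)$, and $A_{\alpha^{-1}}\hat\otimes_A A_\alpha\cong A$, $y\otimes x\mapsto y\alpha^{-1}(x)$. A compatible triple in an Arens–Michael algebra $B$ consists of a continuous algebra homomorphism $\theta:A\to B$ and continuous $A$-bimodule homomorphisms $\phi:A_\alpha\to B$, $\psi:A_{\alpha^{-1}}\to B$ ($B$ being an $A$-bimodule through $\theta$) with $\phi(x)\psi(y)=\theta(x\alpha(y))$ and $\psi(y)\phi(x)=\theta(y\alpha^{-1}(x))$ for all $x,y$. The topological Laurent tensor algebra $\widehat L_A(A_\alpha)$ is an Arens–Michael algebra with a compatible triple that is universal: for every Arens–Michael algebra $B$ and every compatible triple in $B$ there is a unique continuous algebra homomorphism $\widehat L_A(A_\alpha)\to B$ carrying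 the universal triple to the given one. Proposition. $\mathcal O(\mathbb C^\times,A;\alpha)$ is an Arens–Michael algebra, and with the triple $a\mapsto a$, $x\mapsto xt$, $y\mapsto yt^{-1}$ it satisfies this universal property. Hence $\widehat L_A(A_\alpha)$ exists, and for every algebra $\widehat L_A(A_\alpha)$ with universal triple $(\theta,\phi,\psi)$ there is a unique topological algebra isomorphism $\widehat L_A(A_\alpha)\cong\mathcal O(\mathbb C^\times,A;\alpha)$ which carries $\theta(a)$ to $a$ for all $a\in A$, $\phi(1)$ to $t$ and $\psi(1)$ to $t^{-1}$. -/

import Mathlib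

namespace AMLaurent

open Topology MulOpposite

universe u v w

/-- An Arens-Michael algebra: a complete (Hausdorff) complex unital algebra whose topology is
generated by a family of submultiplicative seminorms. -/
class IsArensMichaelAlgebra (A : Type u) [Ring A] [Algebra ℂ A] [UniformSpace A] : Prop
    extends IsUniformAddGroup A, CompleteSpace A, T2Space A where
  exists_submultiplicative : ∃ S : Set (Seminorm ℂ A),
    WithSeminorms (fun q : S => (q : Seminorm ℂ A)) ∧ ∀ q ∈ S, ∀ a b : A, q (a * b) ≤ q a * q b

/-- `m`-localizable families of continuous linear operators on `A`. -/
def IsMLocalizable {A : Type u} [Ring A] [Algebra ℂ A] [UniformSpace A]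
    (F : Set (A →L[ℂ] A)) : Prop :=
  ∃ S : Set (Seminorm ℂ A), WithSeminorms (fun q : S => (q : Seminorm ℂ A)) ∧
    (∀ q ∈ S, ∀ a b : A, q (a * b) ≤ q a * q b) ∧
    ∀ T ∈ F, ∀ q ∈ S, ∃ C : ℝ, 0 < C ∧ ∀ a : A, q (T a) ≤ C * q a

/-- The family `{α, α⁻¹}` of operators attached to a topological automorphism `α`. -/
def autPair {A : Type u} [Ring A] [Algebra ℂ A] [UniformSpace A] (α : A ≃A[ℂ] A) :
    Set (A →L[ℂ] A) :=
  {α.toContinuousAlgHom.toContinuousLinearMap, α.symm.toContinuousAlgHom.toContinuousLinearMap}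

section Bimodules

/-- Complete locally convex bimodules over `A` with jointly continuous actions; the right action
is written as an action of `Aᵐᵒᵖ`. -/
class IsTopBimodule (A M : Type u) [Ring A] [Algebra ℂ A] [UniformSpace A] [AddCommGroup M]
    [Module ℂ M] [Module A M] [Module Aᵐᵒᵖ M] [UniformSpace M] : Prop
    extends IsUniformAddGroup M, CompleteSpace M, T2Space M, PolynormableSpace ℂ M,
      SMulCommClass A Aᵐᵒᵖ M, IsScalarTower ℂ A M where
  isScalarTower_op : IsScalarTower ℂ Aᵐᵒᵖ M
  continuous_left : Continuous fun z : A × M => z.1 • z.2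
  continuous_right : Continuous fun z : M × A => op z.2 • z.1

/-- `(T, φ)` is a completed projective tensor product `M ⊗̂_A N`: `φ` is the universal jointly
continuous `A`-balanced bilinear map from `M × N` to complete (Hausdorff) locally convex spaces.
Here `T` is always a complete locally convex space. -/
structure IsProjectiveTensor (A M N T : Type u) [Ring A] [AddCommGroup M] [Module ℂ M]
    [Module Aᵐᵒᵖ M] [UniformSpace M] [AddCommGroup N] [Module ℂ N] [Module A N] [UniformSpace N]
    [AddCommGroup T] [Module ℂ T] [UniformSpace T] (φ : M →ₗ[ℂ] N →ₗ[ℂ] T) : Prop where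
  continuous : Continuous fun z : M × N => φ z.1 z.2
  balanced : ∀ (x : M) (a : A) (y : N), φ (op a • x) y = φ x (a • y)
  universal : ∀ (E : Type u) [AddCommGroup E] [Module ℂ E] [UniformSpace E] [IsUniformAddGroup E]
    [CompleteSpace E] [T2Space E] [PolynormableSpace ℂ E] (ψ : M →ₗ[ℂ] N →ₗ[ℂ] E),
    (Continuous fun z : M × N => ψ z.1 z.2) →
    (∀ (x : M) (a : A) (y : N), ψ (op a • x) y = ψ x (a • y)) →
    ∃! f : T →L[ℂ] E, ∀ x y, f (φ x y) = ψ x y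

/-- A pair of topologically inverse bimodules `M`, `N = M⁻¹` over `A`. The topological bimodule
isomorphisms `M ⊗̂_A N ≃ A`, `N ⊗̂_A M ≃ A` are recorded by their values `conv₁ x y`, `conv₂ y x` on
elementary tensors. -/
structure InversePair (A M N : Type u) [Ring A] [Algebra ℂ A] [UniformSpace A]
    [AddCommGroup M] [Module ℂ M] [Module A M] [Module Aᵐᵒᵖ M] [UniformSpace M]
    [AddCommGroup N] [Module ℂ N] [Module A N] [Module Aᵐᵒᵖ N] [UniformSpace N] where
  topBimodule_fst : IsTopBimodule A M
  topBimodule_snd : IsTopBimodule A N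
  conv₁ : M →ₗ[ℂ] N →ₗ[ℂ] A
  conv₂ : N →ₗ[ℂ] M →ₗ[ℂ] A
  isTensor₁ : IsProjectiveTensor A M N A conv₁
  isTensor₂ : IsProjectiveTensor A N M A conv₂
  left₁ : ∀ a x y, conv₁ (a • x) y = a * conv₁ x y
  right₁ : ∀ a x y, conv₁ x (op a • y) = conv₁ x y * a
  left₂ : ∀ a y x, conv₂ (a • y) x = a * conv₂ y x
  right₂ : ∀ a y x, conv₂ y (op a • x) = conv₂ y x * a
  assoc₁ : ∀ x y x', conv₁ x y • x' = op (conv₂ y x') • x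
  assoc₂ : ∀ y x y', conv₂ y x • y' = op (conv₁ x y') • y

variable {A M N : Type u} [Ring A] [Algebra ℂ A] [UniformSpace A]
    [AddCommGroup M] [Module ℂ M] [Module A M] [Module Aᵐᵒᵖ M] [UniformSpace M]
    [AddCommGroup N] [Module ℂ N] [Module A N] [Module Aᵐᵒᵖ N] [UniformSpace N]

/-- Topologically compatible triples `(θ, fst, snd, B)` for an inverse pair `M`, `M⁻¹`: a continuous
algebra homomorphism `θ : A → B` and continuous `A`-bimodule maps `M → B`, `M⁻¹ → B`. The two
compatibility squares are stated on elementary tensors, which span a dense subspace of the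
completed projective tensor product. -/
structure CompatibleTriple (P : InversePair A M N) (B : Type v) [Ring B] [Algebra ℂ B]
    [UniformSpace B] where
  θ : A →A[ℂ] B
  fst : M →L[ℂ] B
  snd : N →L[ℂ] B
  fst_left : ∀ a x, fst (a • x) = θ a * fst x
  fst_right : ∀ a x, fst (op a • x) = fst x * θ a
  snd_left : ∀ a y, snd (a • y) = θ a * snd y
  snd_right : ∀ a y, snd (op a • y) = snd y * θ a
  comm₁ : ∀ x y, fst x * snd y = θ (P.conv₁ x y)
  comm₂ : ∀ y x, snd y * fst x = θ (P.conv₂ y x)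

/-- `L` with the triple `T` is the topological Laurent tensor algebra of `M`, i.e. it is an
Arens-Michael algebra and `T` is a universal compatible triple. -/
structure IsTopLaurentTensorAlgebra {P : InversePair A M N} {L : Type w} [Ring L] [Algebra ℂ L]
    [UniformSpace L] (T : CompatibleTriple P L) : Prop where
  isArensMichael : IsArensMichaelAlgebra L
  universal : ∀ (B : Type v) [Ring B] [Algebra ℂ B] [UniformSpace B] [IsArensMichaelAlgebra B]
    (T' : CompatibleTriple P B), ∃! f : L →A[ℂ] B,
      (∀ a, f (T.θ a) = T'.θ a) ∧ (∀ x, f (T.fst x) = T'.fst x) ∧ (∀ y, f (T.snd y) = T'.snd y)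

end Bimodules

section General

variable {A : Type u} [Ring A] [Algebra ℂ A] [UniformSpace A]

theorem continuous_mul_of_submultiplicative {S : Set (Seminorm ℂ A)}
    (hS : WithSeminorms (fun q : S => (q : Seminorm ℂ A)))
    (hm : ∀ q ∈ S, ∀ a b : A, q (a * b) ≤ q a * q b) : ContinuousMul A := by
  have hadd : IsTopologicalAddGroup A := hS.topologicalAddGroup
  refine ⟨continuous_iff_continuousAt.2 fun z₀ => ?_⟩
  refine (hS.tendsto_nhds _ _).2 fun q ε hε => ?_
  have hq : Continuous (q : Seminorm ℂ A) := hS.continuous_seminorm q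
  have hc : Continuous fun z : A × A =>
      (q : Seminorm ℂ A) (z.1 - z₀.1) * (q : Seminorm ℂ A) z.2 +
        (q : Seminorm ℂ A) z₀.1 * (q : Seminorm ℂ A) (z.2 - z₀.2) := by fun_prop
  have ht := hc.tendsto z₀
  simp only [sub_self, map_zero, zero_mul, mul_zero, add_zero] at ht
  filter_upwards [ht.eventually_lt_const hε] with z hz
  refine lt_of_le_of_lt ?_ hz
  have e : z.1 * z.2 - z₀.1 * z₀.2 = (z.1 - z₀.1) * z.2 + z₀.1 * (z.2 - z₀.2) := by noncomm_ring
  rw [e]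
  exact (map_add_le_add _ _ _).trans (add_le_add (hm _ q.2 _ _) (hm _ q.2 _ _))

theorem IsArensMichaelAlgebra.continuousMul [IsArensMichaelAlgebra A] : ContinuousMul A := by
  obtain ⟨S, hS, hm⟩ := IsArensMichaelAlgebra.exists_submultiplicative (A := A)
  exact continuous_mul_of_submultiplicative hS hm

theorem IsArensMichaelAlgebra.polynormable [IsArensMichaelAlgebra A] : PolynormableSpace ℂ A := by
  obtain ⟨S, hS, -⟩ := IsArensMichaelAlgebra.exists_submultiplicative (A := A)
  exact hS.toPolynormableSpace

theorem seminorm_sum_le {A : Type u} [Ring A] [Algebra ℂ A] {β : Type*} (q : Seminorm ℂ A) (u : β → A) (s : Finset β) :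
    q (∑ b ∈ s, u b) ≤ ∑ b ∈ s, q (u b) :=
  Finset.le_sum_of_subadditive q (map_zero q).le (map_add_le_add q) s u

theorem summable_of_seminorms [IsArensMichaelAlgebra A] {S : Set (Seminorm ℂ A)}
    (hS : WithSeminorms (fun q : S => (q : Seminorm ℂ A))) {β : Type*} (u : β → A)
    (h : ∀ q ∈ S, Summable fun b => q (u b)) : Summable u := by
  refine summable_iff_vanishing.2 fun e he => ?_
  obtain ⟨s, r, hr, hse⟩ := (hS.mem_nhds_iff 0 e).1 he
  have hg : Summable fun b => ∑ q ∈ s, (q : Seminorm ℂ A) (u b) :=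
    summable_sum fun q _ => h q q.2
  obtain ⟨t, ht⟩ := summable_iff_vanishing.1 hg _ (Metric.ball_mem_nhds 0 hr)
  refine ⟨t, fun t' htt => hse ?_⟩
  have h1 := ht t' htt
  rw [Metric.mem_ball, dist_zero_right] at h1
  rw [Seminorm.mem_ball, sub_zero]
  refine lt_of_le_of_lt ?_ ((le_abs_self _).trans_lt h1)
  refine (seminorm_sum_le _ _ _).trans (Finset.sum_le_sum fun b _ => ?_)
  have h2 := Seminorm.finset_sup_le_sum (fun q : S => (q : Seminorm ℂ A)) s (u b)
  have h3 : (∑ q ∈ s, (q : Seminorm ℂ A)) (u b) = ∑ q ∈ s, (q : Seminorm ℂ A) (u b) := by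
    rw [← FunLike.coeAddMonoidHom_apply, map_sum, Finset.sum_apply]
    rfl
  exact h2.trans_eq h3

theorem seminorm_tsum_le {β : Type*} (q : Seminorm ℂ A) (hq : Continuous q) {u : β → A}
    (hu : Summable u) (hqu : Summable fun b => q (u b)) : q (∑' b, u b) ≤ ∑' b, q (u b) :=
  le_of_tendsto ((hq.tendsto _).comp hu.hasSum) (Filter.Eventually.of_forall fun s =>
    (seminorm_sum_le q u s).trans (hqu.sum_le_tsum s fun _ _ => apply_nonneg _ _))

end General

section Twist

variable {A : Type u} [Ring A] [Algebra ℂ A] [UniformSpace A]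

/-- The bimodule `A_α`: it is `A` as a left module, with right action `x ∘ a = x * α a`. -/
def Twist (_α : A ≃A[ℂ] A) : Type u := A

variable (α : A ≃A[ℂ] A)

instance : AddCommGroup (Twist α) := inferInstanceAs (AddCommGroup A)
instance : UniformSpace (Twist α) := inferInstanceAs (UniformSpace A)
instance : Module ℂ (Twist α) := inferInstanceAs (Module ℂ A)
instance : Module A (Twist α) := inferInstanceAs (Module A A)
instance : Module Aᵐᵒᵖ (Twist α) := Module.compHom A (RingHom.op (α.toAlgEquiv : A →+* A))

/-- The identity maps between `A` and `A_α`. -/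
def Twist.of : A ≃ₗ[ℂ] Twist α := LinearEquiv.refl ℂ A

theorem Twist.smul_of (a x : A) : a • Twist.of α x = Twist.of α (a * x) := rfl

theorem Twist.op_smul_of (a x : A) : op a • Twist.of α x = Twist.of α (x * α a) := rfl

theorem Twist.of_symm_smul (a : A) (x : Twist α) :
    (Twist.of α).symm (a • x) = a * (Twist.of α).symm x := rfl

theorem Twist.of_symm_op_smul (a : A) (x : Twist α) :
    (Twist.of α).symm (op a • x) = (Twist.of α).symm x * α a := rfl

theorem Twist.continuous_of : Continuous (Twist.of α) := continuous_id

theorem Twist.continuous_of_symm : Continuous (Twist.of α).symm := continuous_id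

theorem Twist.isTopBimodule [hA : IsArensMichaelAlgebra A] : IsTopBimodule A (Twist α) :=
  have hm : ContinuousMul A := IsArensMichaelAlgebra.continuousMul
  { toIsUniformAddGroup := inferInstanceAs (IsUniformAddGroup A)
    toCompleteSpace := inferInstanceAs (CompleteSpace A)
    toT2Space := inferInstanceAs (T2Space A)
    toPolynormableSpace := (IsArensMichaelAlgebra.polynormable : PolynormableSpace ℂ A)
    smul_comm := fun a b x => (mul_assoc a ((Twist.of α).symm x) (α b.unop)).symm
    smul_assoc := fun c a x => smul_mul_assoc c a ((Twist.of α).symm x)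
    isScalarTower_op := ⟨fun c a x => by
      change (Twist.of α).symm x * α (c • a.unop) = c • ((Twist.of α).symm x * α a.unop)
      rw [map_smul, mul_smul_comm]⟩
    continuous_left := (continuous_mul : Continuous fun z : A × A => z.1 * z.2)
    continuous_right := (continuous_fst.mul (α.continuous.comp continuous_snd) :
      Continuous fun z : A × A => z.1 * α z.2) }

/-- The pairing `(x, y) ↦ x * α y`. -/
def twistConv (β γ : A ≃A[ℂ] A) : Twist β →ₗ[ℂ] Twist γ →ₗ[ℂ] A :=
  (LinearMap.mul ℂ A).compl₁₂ (Twist.of β).symm.toLinearMap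
    (β.toAlgEquiv.toLinearMap ∘ₗ (Twist.of γ).symm.toLinearMap)

theorem twistConv_apply (β γ : A ≃A[ℂ] A) (x : Twist β) (y : Twist γ) :
    twistConv β γ x y = (Twist.of β).symm x * β ((Twist.of γ).symm y) := rfl

theorem isProjectiveTensor_twistConv [IsArensMichaelAlgebra A] (β γ : A ≃A[ℂ] A) :
    IsProjectiveTensor A (Twist β) (Twist γ) A (twistConv β γ) := by
  have hm : ContinuousMul A := IsArensMichaelAlgebra.continuousMul
  refine ⟨?_, ?_, ?_⟩
  · exact (continuous_fst.mul (β.continuous.comp continuous_snd) :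
      Continuous fun z : A × A => z.1 * β z.2)
  · intro x a y
    rw [twistConv_apply, twistConv_apply, Twist.of_symm_op_smul, Twist.of_symm_smul, map_mul,
      mul_assoc]
  · intro E _ _ _ _ _ _ _ ψ hψ hbal
    have hc : Continuous fun a : A => ψ (Twist.of β a) (Twist.of γ 1) :=
      hψ.comp ((Twist.continuous_of β).prodMk continuous_const)
    refine ⟨⟨(ψ.flip (Twist.of γ 1)) ∘ₗ (Twist.of β).toLinearMap, hc⟩, ?_, ?_⟩
    · intro x y
      have h := hbal x ((Twist.of γ).symm y) (Twist.of γ 1)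
      rw [Twist.smul_of, mul_one, LinearEquiv.apply_symm_apply] at h
      exact h
    · intro f hf
      ext a
      have h := hf (Twist.of β a) (Twist.of γ 1)
      rw [twistConv_apply, LinearEquiv.symm_apply_apply, LinearEquiv.symm_apply_apply, map_one,
        mul_one] at h
      exact h

/-- `A_α` and `A_{α⁻¹}` are topologically inverse with respect to `x ⊗ y ↦ x * α y` and
`y ⊗ x ↦ y * α⁻¹ x`. -/
def twistPair [IsArensMichaelAlgebra A] : InversePair A (Twist α) (Twist α.symm) where
  topBimodule_fst := Twist.isTopBimodule α
  topBimodule_snd := Twist.isTopBimodule α.symm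
  conv₁ := twistConv α α.symm
  conv₂ := twistConv α.symm α
  isTensor₁ := isProjectiveTensor_twistConv α α.symm
  isTensor₂ := isProjectiveTensor_twistConv α.symm α
  left₁ a x y := by simp only [twistConv_apply, Twist.of_symm_smul, mul_assoc]
  right₁ a x y := by
    simp only [twistConv_apply, Twist.of_symm_op_smul, map_mul, mul_assoc,
      ContinuousAlgEquiv.apply_symm_apply]
  left₂ a y x := by simp only [twistConv_apply, Twist.of_symm_smul, mul_assoc]
  right₂ a y x := by
    simp only [twistConv_apply, Twist.of_symm_op_smul, map_mul, mul_assoc,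
      ContinuousAlgEquiv.symm_apply_apply]
  assoc₁ x y x' := by
    apply (Twist.of α).symm.injective
    simp only [twistConv_apply, Twist.of_symm_smul, Twist.of_symm_op_smul, map_mul, mul_assoc,
      ContinuousAlgEquiv.apply_symm_apply]
  assoc₂ y x y' := by
    apply (Twist.of α.symm).symm.injective
    simp only [twistConv_apply, Twist.of_symm_smul, Twist.of_symm_op_smul, map_mul, mul_assoc,
      ContinuousAlgEquiv.symm_apply_apply]

end Twist

section LaurentSpace

variable {A : Type u} [Ring A] [Algebra ℂ A] {Λ : Type w}

/-- The vector space `O(ℂ^×, A)` attached to a family of seminorms `p` on `A`: two-sided sequences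
`(f n)`, thought of as `∑ f n t^n`, with `∑ p l (f n) ρ^n < ∞` for all `l` and all `0 < ρ < ∞`. -/
def laurentSpace (p : SeminormFamily ℂ A Λ) : Submodule ℂ (ℤ → A) where
  carrier := {f | ∀ (l : Λ) (ρ : ℝ), 0 < ρ → Summable fun n : ℤ => p l (f n) * ρ ^ n}
  zero_mem' := fun l ρ _ => by simp
  add_mem' := fun {f g} hf hg l ρ hρ => by
    refine Summable.of_nonneg_of_le (fun n => by positivity) (fun n => ?_)
      ((hf l ρ hρ).add (hg l ρ hρ))
    rw [← add_mul]
    exact mul_le_mul_of_nonneg_right (map_add_le_add _ _ _) (by positivity)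
  smul_mem' := fun c f hf l ρ hρ => by
    refine ((hf l ρ hρ).mul_left ‖c‖).congr fun n => ?_
    rw [Pi.smul_apply, map_smul_eq_mul, mul_assoc]

theorem mem_laurentSpace {p : SeminormFamily ℂ A Λ} {f : ℤ → A} : f ∈ laurentSpace p ↔
    ∀ (l : Λ) (ρ : ℝ), 0 < ρ → Summable fun n : ℤ => p l (f n) * ρ ^ n := Iff.rfl

/-- The seminorm `‖f‖_{l,ρ} = ∑ p l (f n) ρ^n`. -/
noncomputable def laurentSeminorm (p : SeminormFamily ℂ A Λ) :
    SeminormFamily ℂ (laurentSpace p) (Λ × {ρ : ℝ // 0 < ρ}) := fun i =>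
  Seminorm.of (fun f => ∑' n : ℤ, p i.1 ((f : ℤ → A) n) * (i.2 : ℝ) ^ n)
    (fun f g => by
      have hρ := i.2.2
      have hf := f.2 i.1 i.2 hρ
      have hg := g.2 i.1 i.2 hρ
      rw [← hf.tsum_add hg]
      refine ((f + g).2 i.1 i.2 hρ).tsum_le_tsum (fun n => ?_) (hf.add hg)
      rw [← add_mul]
      exact mul_le_mul_of_nonneg_right (map_add_le_add _ _ _) (by positivity))
    (fun c f => by
      rw [← tsum_mul_left]
      refine tsum_congr fun n => ?_
      rw [← mul_assoc, ← map_smul_eq_mul]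
      rfl)

theorem laurentSeminorm_apply (p : SeminormFamily ℂ A Λ) (i : Λ × {ρ : ℝ // 0 < ρ})
    (f : laurentSpace p) :
    laurentSeminorm p i f = ∑' n : ℤ, p i.1 ((f : ℤ → A) n) * (i.2 : ℝ) ^ n := rfl

/-- The uniform structure on `O(ℂ^×, A)` generated by the seminorms `‖·‖_{l,ρ}`. -/
@[reducible]
noncomputable def laurentUniformSpace (p : SeminormFamily ℂ A Λ) :
    UniformSpace (laurentSpace p) :=
  ⨅ i, (laurentSeminorm p i).toSeminormedAddCommGroup.toUniformSpace

theorem zpow_le_natAbs_pow {ρ : ℝ} (hρ : 0 < ρ) {D : ℝ} (h1 : ρ ≤ D) (h2 : ρ⁻¹ ≤ D) (n : ℤ) :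
    ρ ^ n ≤ D ^ n.natAbs := by
  obtain ⟨k, rfl | rfl⟩ := n.eq_nat_or_neg
  · simpa using pow_le_pow_left₀ hρ.le h1 k
  · simpa using pow_le_pow_left₀ (inv_pos.2 hρ).le h2 k

theorem natAbs_pow_le_zpow {D : ℝ} (hD : 0 < D) (n : ℤ) :
    D ^ n.natAbs ≤ D ^ n + D⁻¹ ^ n := by
  obtain ⟨k, rfl | rfl⟩ := n.eq_nat_or_neg
  · have : 0 ≤ (D⁻¹) ^ (k : ℤ) := by positivity
    simpa using this
  · have : 0 ≤ D ^ (-(k : ℤ)) := by positivity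
    simpa using this

theorem single_mem (p : SeminormFamily ℂ A Λ) (n : ℤ) (a : A) :
    Pi.single n a ∈ laurentSpace p := fun l ρ _ => by
  refine summable_of_ne_finset_zero (s := {n}) fun m hm => ?_
  rw [Pi.single_eq_of_ne (by simpa using hm), map_zero, zero_mul]

variable [UniformSpace A]

theorem summable_natAbs {p : SeminormFamily ℂ A Λ} (hp : WithSeminorms p) {f : ℤ → A}
    (hf : f ∈ laurentSpace p) (q : Seminorm ℂ A) (hq : Continuous q) {D : ℝ} (hD : 0 < D) :
    Summable fun n : ℤ => q (f n) * D ^ n.natAbs := by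
  obtain ⟨s, C, -, hC⟩ := Seminorm.bound_of_continuous hp q hq
  have h1 : Summable fun n : ℤ =>
      (C : ℝ) * ∑ l ∈ s, (p l (f n) * D ^ n + p l (f n) * D⁻¹ ^ n) :=
    (summable_sum fun l _ => (hf l D hD).add (hf l D⁻¹ (inv_pos.2 hD))).mul_left _
  refine Summable.of_nonneg_of_le (fun n => by positivity) (fun n => ?_) h1
  have h2 : s.sup p (f n) ≤ ∑ l ∈ s, p l (f n) := by
    refine (Seminorm.finset_sup_le_sum p s (f n)).trans_eq ?_
    rw [← FunLike.coeAddMonoidHom_apply, map_sum, Finset.sum_apply]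
    rfl
  have h3 : q (f n) ≤ C * ∑ l ∈ s, p l (f n) :=
    (hC (f n)).trans (mul_le_mul_of_nonneg_left h2 C.2)
  calc q (f n) * D ^ n.natAbs
      ≤ (C * ∑ l ∈ s, p l (f n)) * (D ^ n + D⁻¹ ^ n) :=
        mul_le_mul h3 (natAbs_pow_le_zpow hD n) (by positivity)
          ((apply_nonneg _ _).trans h3)
    _ = _ := by
        rw [mul_assoc, Finset.sum_mul]
        congr 1
        exact Finset.sum_congr rfl fun l _ => mul_add _ _ _

theorem mem_of_summable_natAbs {p : SeminormFamily ℂ A Λ} (hp : WithSeminorms p)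
    {S : Set (Seminorm ℂ A)} (hS : WithSeminorms (fun q : S => (q : Seminorm ℂ A))) {f : ℤ → A}
    (h : ∀ q ∈ S, ∀ D : ℝ, 1 ≤ D → Summable fun n : ℤ => q (f n) * D ^ n.natAbs) :
    f ∈ laurentSpace p := by
  have hS' : f ∈ laurentSpace (fun q : S => (q : Seminorm ℂ A)) := fun q ρ hρ => by
    have hD : 1 ≤ max (max ρ ρ⁻¹) 1 := le_max_right _ _
    refine Summable.of_nonneg_of_le (fun n => by positivity) (fun n => ?_) (h q q.2 _ hD)
    exact mul_le_mul_of_nonneg_left (zpow_le_natAbs_pow hρ ((le_max_left _ _).trans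
      (le_max_left _ _)) ((le_max_right _ _).trans (le_max_left _ _)) n) (apply_nonneg _ _)
  intro l ρ hρ
  have hD : 0 < max ρ ρ⁻¹ := lt_max_of_lt_left hρ
  refine Summable.of_nonneg_of_le (fun n => by positivity) (fun n => ?_)
    (summable_natAbs hS hS' (p l) (hp.continuous_seminorm l) hD)
  exact mul_le_mul_of_nonneg_left (zpow_le_natAbs_pow hρ (le_max_left _ _) (le_max_right _ _) n)
    (apply_nonneg _ _)

end LaurentSpace

section Twisted

variable {A : Type u} [Ring A] [Algebra ℂ A] [UniformSpace A] {Λ : Type w}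

/-- The coefficients of the twisted product: `(f g)_n = ∑ f_i α^i(g_{n-i})`. -/
noncomputable def twistedMul (α : A ≃A[ℂ] A) (f g : ℤ → A) (n : ℤ) : A :=
  ∑' i : ℤ, f i * (α.toAlgEquiv ^ i) (g (n - i))

theorem continuous_zpow (α : A ≃A[ℂ] A) (n : ℤ) : Continuous (α.toAlgEquiv ^ n) := by
  induction n with
  | zero => exact continuous_id
  | succ k ih =>
    rw [zpow_add_one]
    exact ih.comp α.continuous
  | pred k ih =>
    rw [zpow_sub_one]
    exact ih.comp α.symm.continuous

theorem seminorm_zpow_le (α : A ≃A[ℂ] A) (q : Seminorm ℂ A) {C : ℝ} (hC : 1 ≤ C)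
    (h1 : ∀ a, q (α a) ≤ C * q a) (h2 : ∀ a, q (α.symm a) ≤ C * q a) (n : ℤ) (a : A) :
    q ((α.toAlgEquiv ^ n) a) ≤ C ^ n.natAbs * q a := by
  have hC0 : 0 ≤ C := zero_le_one.trans hC
  have key : ∀ (β : A ≃ₐ[ℂ] A), (∀ a, q (β a) ≤ C * q a) → ∀ (k : ℕ) (a : A),
      q ((β ^ k) a) ≤ C ^ k * q a := by
    intro β hβ k
    induction k with
    | zero => intro a; simp
    | succ k ih =>
      intro a
      rw [pow_succ, pow_succ, mul_assoc]
      exact (ih (β a)).trans (mul_le_mul_of_nonneg_left (hβ a) (by positivity))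
  obtain ⟨k, rfl | rfl⟩ := n.eq_nat_or_neg
  · simpa using key α.toAlgEquiv h1 k a
  · have h := key (α.toAlgEquiv⁻¹) h2 k a
    simpa using h

theorem exists_const (α : A ≃A[ℂ] A) {S : Set (Seminorm ℂ A)}
    (h : ∀ T ∈ autPair α, ∀ q ∈ S, ∃ C : ℝ, 0 < C ∧ ∀ a : A, q (T a) ≤ C * q a)
    {q : Seminorm ℂ A} (hq : q ∈ S) : ∃ C : ℝ, 1 ≤ C ∧ ∀ (n : ℤ) (a : A),
      q ((α.toAlgEquiv ^ n) a) ≤ C ^ n.natAbs * q a := by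
  obtain ⟨C₁, -, h1⟩ := h α.toContinuousAlgHom.toContinuousLinearMap (Or.inl rfl) q hq
  obtain ⟨C₂, -, h2⟩ := h α.symm.toContinuousAlgHom.toContinuousLinearMap (Or.inr rfl) q hq
  refine ⟨max (max C₁ C₂) 1, le_max_right _ _, seminorm_zpow_le α q (le_max_right _ _)
    (fun a => (h1 a).trans ?_) (fun a => (h2 a).trans ?_)⟩
  · exact mul_le_mul_of_nonneg_right ((le_max_left _ _).trans (le_max_left _ _))
      (apply_nonneg _ _)
  · exact mul_le_mul_of_nonneg_right ((le_max_right _ _).trans (le_max_left _ _))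
      (apply_nonneg _ _)

theorem summable_mul_aux (α : A ≃A[ℂ] A) {p : SeminormFamily ℂ A Λ} (hp : WithSeminorms p)
    {q : Seminorm ℂ A} (hq : Continuous q) (hm : ∀ a b : A, q (a * b) ≤ q a * q b) {C : ℝ}
    (hC : 1 ≤ C) (hα : ∀ (n : ℤ) (a : A), q ((α.toAlgEquiv ^ n) a) ≤ C ^ n.natAbs * q a)
    {f g : ℤ → A} (hf : f ∈ laurentSpace p) (hg : g ∈ laurentSpace p) {D : ℝ} (hD : 1 ≤ D) :
    Summable fun z : ℤ × ℤ =>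
      q (f z.1 * (α.toAlgEquiv ^ z.1) (g (z.2 - z.1))) * D ^ z.2.natAbs := by
  have hC0 : 0 < C := zero_lt_one.trans_le hC
  have hD0 : 0 < D := zero_lt_one.trans_le hD
  have h1 := (summable_natAbs hp hf q hq (mul_pos hC0 hD0)).mul_of_nonneg
    (summable_natAbs hp hg q hq hD0) (fun n => by positivity) (fun n => by positivity)
  let e : ℤ × ℤ ≃ ℤ × ℤ :=
    { toFun := fun z => (z.1, z.2 - z.1)
      invFun := fun z => (z.1, z.2 + z.1)
      left_inv := fun z => by simp
      right_inv := fun z => by simp }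
  refine Summable.of_nonneg_of_le (fun z => by positivity) (fun z => ?_)
    ((e.summable_iff).2 h1)
  change _ ≤ q (f z.1) * (C * D) ^ z.1.natAbs * (q (g (z.2 - z.1)) * D ^ (z.2 - z.1).natAbs)
  have h2 : D ^ z.2.natAbs ≤ D ^ z.1.natAbs * D ^ (z.2 - z.1).natAbs := by
    rw [← pow_add]
    exact pow_le_pow_right₀ hD (by omega)
  have h3 : q (f z.1 * (α.toAlgEquiv ^ z.1) (g (z.2 - z.1))) ≤
      q (f z.1) * (C ^ z.1.natAbs * q (g (z.2 - z.1))) :=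
    (hm _ _).trans (mul_le_mul_of_nonneg_left (hα _ _) (apply_nonneg _ _))
  calc _ ≤ (q (f z.1) * (C ^ z.1.natAbs * q (g (z.2 - z.1)))) *
        (D ^ z.1.natAbs * D ^ (z.2 - z.1).natAbs) :=
        mul_le_mul h3 h2 (by positivity) (by positivity)
    _ = _ := by rw [mul_pow]; ring

theorem summable_mul [IsArensMichaelAlgebra A] {α : A ≃A[ℂ] A} (hα : IsMLocalizable (autPair α))
    {p : SeminormFamily ℂ A Λ} (hp : WithSeminorms p) {f g : ℤ → A} (hf : f ∈ laurentSpace p)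
    (hg : g ∈ laurentSpace p) (n : ℤ) :
    Summable fun i : ℤ => f i * (α.toAlgEquiv ^ i) (g (n - i)) := by
  obtain ⟨S, hS, hm, hloc⟩ := hα
  refine summable_of_seminorms hS _ fun q hq => ?_
  obtain ⟨C, hC, hC'⟩ := exists_const α hloc hq
  have h := summable_mul_aux α hp (hS.continuous_seminorm ⟨q, hq⟩) (hm q hq) hC hC' hf hg le_rfl
  simpa using h.prod_symm.prod_factor n

theorem twistedMul_mem [IsArensMichaelAlgebra A] {α : A ≃A[ℂ] A}
    (hα : IsMLocalizable (autPair α)) {p : SeminormFamily ℂ A Λ} (hp : WithSeminorms p)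
    {f g : ℤ → A} (hf : f ∈ laurentSpace p) (hg : g ∈ laurentSpace p) :
    twistedMul α f g ∈ laurentSpace p := by
  have hsum := fun n => summable_mul hα hp hf hg n
  obtain ⟨S, hS, hm, hloc⟩ := hα
  refine mem_of_summable_natAbs hp hS fun q hq D hD => ?_
  obtain ⟨C, hC, hC'⟩ := exists_const α hloc hq
  have hqc : Continuous q := hS.continuous_seminorm ⟨q, hq⟩
  have hD0 : 0 < D := zero_lt_one.trans_le hD
  have h := summable_mul_aux α hp hqc (hm q hq) hC hC' hf hg hD
  refine Summable.of_nonneg_of_le (fun n => by positivity) (fun n => ?_) h.prod_symm.prod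
  simp only [Prod.swap_prod_mk]
  rw [tsum_mul_right]
  refine mul_le_mul_of_nonneg_right (seminorm_tsum_le q hqc (hsum n) ?_) (by positivity)
  have h' := summable_mul_aux α hp hqc (hm q hq) hC hC' hf hg le_rfl
  simpa using h'.prod_symm.prod_factor n

theorem twistedMul_add [IsArensMichaelAlgebra A] {α : A ≃A[ℂ] A}
    (hα : IsMLocalizable (autPair α)) {p : SeminormFamily ℂ A Λ} (hp : WithSeminorms p)
    {f g h : ℤ → A} (hf : f ∈ laurentSpace p) (hg : g ∈ laurentSpace p)
    (hh : h ∈ laurentSpace p) :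
    twistedMul α f (g + h) = twistedMul α f g + twistedMul α f h := by
  funext n
  have h1 := (summable_mul hα hp hf hg n).tsum_add (summable_mul hα hp hf hh n)
  refine Eq.trans (tsum_congr fun i => ?_) h1
  rw [Pi.add_apply, map_add, mul_add]

theorem add_twistedMul [IsArensMichaelAlgebra A] {α : A ≃A[ℂ] A}
    (hα : IsMLocalizable (autPair α)) {p : SeminormFamily ℂ A Λ} (hp : WithSeminorms p)
    {f g h : ℤ → A} (hf : f ∈ laurentSpace p) (hg : g ∈ laurentSpace p)
    (hh : h ∈ laurentSpace p) :
    twistedMul α (f + g) h = twistedMul α f h + twistedMul α g h := by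
  funext n
  have h1 := (summable_mul hα hp hf hh n).tsum_add (summable_mul hα hp hg hh n)
  refine Eq.trans (tsum_congr fun i => ?_) h1
  rw [Pi.add_apply, add_mul]

theorem smul_twistedMul [IsArensMichaelAlgebra A] (α : A ≃A[ℂ] A) (c : ℂ) (f g : ℤ → A) :
    twistedMul α (c • f) g = c • twistedMul α f g := by
  have : ContinuousConstSMul ℂ A := by
    obtain ⟨S, hS, -⟩ := IsArensMichaelAlgebra.exists_submultiplicative (A := A)
    have := hS.continuousSMul
    infer_instance
  funext n
  rw [Pi.smul_apply, twistedMul, twistedMul, ← tsum_const_smul'']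
  exact tsum_congr fun i => by rw [Pi.smul_apply, smul_mul_assoc]

theorem twistedMul_smul [IsArensMichaelAlgebra A] (α : A ≃A[ℂ] A) (c : ℂ) (f g : ℤ → A) :
    twistedMul α f (c • g) = c • twistedMul α f g := by
  have : ContinuousConstSMul ℂ A := by
    obtain ⟨S, hS, -⟩ := IsArensMichaelAlgebra.exists_submultiplicative (A := A)
    have := hS.continuousSMul
    infer_instance
  funext n
  rw [Pi.smul_apply, twistedMul, twistedMul, ← tsum_const_smul'']
  exact tsum_congr fun i => by rw [Pi.smul_apply, map_smul, mul_smul_comm]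

theorem summable_mul_mul [IsArensMichaelAlgebra A] {α : A ≃A[ℂ] A}
    (hα : IsMLocalizable (autPair α)) {p : SeminormFamily ℂ A Λ} (hp : WithSeminorms p)
    {f g h : ℤ → A} (hf : f ∈ laurentSpace p) (hg : g ∈ laurentSpace p)
    (hh : h ∈ laurentSpace p) (n : ℤ) :
    Summable (Function.uncurry fun i m : ℤ =>
      f i * (α.toAlgEquiv ^ i) (g (m - i)) * (α.toAlgEquiv ^ m) (h (n - m))) := by
  obtain ⟨S, hS, hm, hloc⟩ := hα
  refine summable_of_seminorms hS _ fun q hq => ?_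
  obtain ⟨C, hC, hC'⟩ := exists_const α hloc hq
  have hqc : Continuous q := hS.continuous_seminorm ⟨q, hq⟩
  have hh1 := summable_natAbs hp hh q hqc one_pos
  have hK : ∀ k, q (h k) ≤ ∑' n : ℤ, q (h n) * (1 : ℝ) ^ n.natAbs := fun k => by
    simpa using hh1.le_tsum k fun _ _ => by positivity
  refine Summable.of_nonneg_of_le (fun z => apply_nonneg _ _) (fun z => ?_)
    ((summable_mul_aux α hp hqc (hm q hq) hC hC' hf hg hC).mul_right
      (∑' n : ℤ, q (h n) * (1 : ℝ) ^ n.natAbs))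
  obtain ⟨i, m⟩ := z
  have hC0 : 0 < C := zero_lt_one.trans_le hC
  refine (hm q hq _ _).trans ?_
  rw [mul_assoc]
  refine mul_le_mul_of_nonneg_left ((hC' m _).trans ?_) (apply_nonneg _ _)
  exact mul_le_mul_of_nonneg_left (hK _) (by positivity)

theorem twistedMul_assoc [IsArensMichaelAlgebra A] {α : A ≃A[ℂ] A}
    (hα : IsMLocalizable (autPair α)) {p : SeminormFamily ℂ A Λ} (hp : WithSeminorms p)
    {f g h : ℤ → A} (hf : f ∈ laurentSpace p) (hg : g ∈ laurentSpace p)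
    (hh : h ∈ laurentSpace p) :
    twistedMul α (twistedMul α f g) h = twistedMul α f (twistedMul α g h) := by
  have hcm : ContinuousMul A := IsArensMichaelAlgebra.continuousMul
  have hts : IsTopologicalSemiring A := {}
  funext n
  have h1 : twistedMul α (twistedMul α f g) h n = ∑' (m : ℤ) (i : ℤ),
      f i * (α.toAlgEquiv ^ i) (g (m - i)) * (α.toAlgEquiv ^ m) (h (n - m)) :=
    tsum_congr fun m => ((summable_mul hα hp hf hg m).tsum_mul_right _).symm
  rw [h1, (summable_mul_mul hα hp hf hg hh n).tsum_comm]
  refine tsum_congr fun i => ?_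
  have hs := summable_mul hα hp hg hh (n - i)
  have h2 : (α.toAlgEquiv ^ i) (twistedMul α g h (n - i)) =
      ∑' k : ℤ, (α.toAlgEquiv ^ i) (g k * (α.toAlgEquiv ^ k) (h (n - i - k))) :=
    hs.map_tsum (α.toAlgEquiv ^ i) (continuous_zpow α i)
  have hs' : Summable fun k : ℤ =>
      (α.toAlgEquiv ^ i) (g k * (α.toAlgEquiv ^ k) (h (n - i - k))) :=
    hs.map (α.toAlgEquiv ^ i) (continuous_zpow α i)
  rw [h2, ← hs'.tsum_mul_left, ← (Equiv.addLeft i).tsum_eq]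
  refine tsum_congr fun m => ?_
  rw [Equiv.coe_addLeft, map_mul, ← mul_assoc, ← AlgEquiv.mul_apply, ← zpow_add,
    add_sub_cancel_left, sub_sub]

theorem twistedMul_single (α : A ≃A[ℂ] A) (m n : ℤ) (a b : A) :
    twistedMul α (Pi.single m a) (Pi.single n b) =
      Pi.single (m + n) (a * (α.toAlgEquiv ^ m) b) := by
  funext k
  rw [twistedMul, tsum_eq_single m fun i hi => by rw [Pi.single_eq_of_ne hi, zero_mul],
    Pi.single_eq_same]
  by_cases hk : k = m + n
  · subst hk
    rw [Pi.single_eq_same, add_sub_cancel_left, Pi.single_eq_same]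
  · rw [Pi.single_eq_of_ne hk, Pi.single_eq_of_ne (by omega), map_zero, mul_zero]

theorem one_twistedMul (α : A ≃A[ℂ] A) (f : ℤ → A) : twistedMul α (Pi.single 0 1) f = f := by
  funext k
  rw [twistedMul, tsum_eq_single 0 fun i hi => by rw [Pi.single_eq_of_ne hi, zero_mul],
    Pi.single_eq_same, one_mul, zpow_zero, sub_zero]
  rfl

theorem twistedMul_one (α : A ≃A[ℂ] A) (f : ℤ → A) : twistedMul α f (Pi.single 0 1) = f := by
  funext k
  rw [twistedMul, tsum_eq_single k fun i hi => by
    rw [Pi.single_eq_of_ne (by omega), map_zero, mul_zero], sub_self, Pi.single_eq_same, map_one,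
    mul_one]

/-- The space underlying `O(ℂ^×, A; α)`; the hypotheses that make the twisted product well defined
are parameters of the type. -/
def TwistedLaurent (α : A ≃A[ℂ] A) (_hα : IsMLocalizable (autPair α)) (p : SeminormFamily ℂ A Λ)
    (_hp : WithSeminorms p) : Type u := laurentSpace p

namespace TwistedLaurent

variable {α : A ≃A[ℂ] A} {hα : IsMLocalizable (autPair α)} {p : SeminormFamily ℂ A Λ}
  {hp : WithSeminorms p}

instance : AddCommGroup (TwistedLaurent α hα p hp) := inferInstanceAs (AddCommGroup (laurentSpace p))
instance : Module ℂ (TwistedLaurent α hα p hp) := inferInstanceAs (Module ℂ (laurentSpace p))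

noncomputable instance : UniformSpace (TwistedLaurent α hα p hp) := laurentUniformSpace p

/-- The twisted Laurent series algebra structure: `(∑ a_i t^i)(∑ b_j t^j) = ∑ a_i α^i(b_j) t^{i+j}`. -/
noncomputable instance [IsArensMichaelAlgebra A] : Ring (TwistedLaurent α hα p hp) :=
  { (inferInstance : AddCommGroup (TwistedLaurent α hα p hp)) with
    mul := fun f g => ⟨twistedMul α f.1 g.1, twistedMul_mem hα hp f.2 g.2⟩
    one := ⟨Pi.single 0 1, single_mem p 0 1⟩
    left_distrib := fun f g h => Subtype.ext (twistedMul_add hα hp f.2 g.2 h.2)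
    right_distrib := fun f g h => Subtype.ext (add_twistedMul hα hp f.2 g.2 h.2)
    zero_mul := fun f => Subtype.ext (funext fun n => by
      change ∑' i : ℤ, (0 : A) * _ = 0
      simp)
    mul_zero := fun f => Subtype.ext (funext fun n => by
      change ∑' i : ℤ, _ * (α.toAlgEquiv ^ i) (0 : A) = 0
      simp)
    mul_assoc := fun f g h => Subtype.ext (twistedMul_assoc hα hp f.2 g.2 h.2)
    one_mul := fun f => Subtype.ext (one_twistedMul α f.1)
    mul_one := fun f => Subtype.ext (twistedMul_one α f.1) }

noncomputable instance [IsArensMichaelAlgebra A] : Algebra ℂ (TwistedLaurent α hα p hp) :=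
  Algebra.ofModule (fun c f g => Subtype.ext (smul_twistedMul α c f.1 g.1))
    (fun c f g => Subtype.ext (twistedMul_smul α c f.1 g.1))

/-- The seminorms `‖·‖_{l,ρ}` on `O(ℂ^×, A; α)`. -/
noncomputable def seminorms :
    SeminormFamily ℂ (TwistedLaurent α hα p hp) (Λ × {ρ : ℝ // 0 < ρ}) := laurentSeminorm p

theorem isUniformAddGroup : IsUniformAddGroup (TwistedLaurent α hα p hp) :=
  isUniformAddGroup_iInf (G := laurentSpace p) fun i =>
    @SeminormedAddCommGroup.to_isUniformAddGroup _ (laurentSeminorm p i).toSeminormedAddCommGroup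

theorem withSeminorms : WithSeminorms (seminorms (α := α) (hα := hα) (p := p) (hp := hp)) := by
  have := isUniformAddGroup (α := α) (hα := hα) (p := p) (hp := hp)
  exact seminorms.withSeminorms_iff_uniformSpace_eq_iInf.2 rfl

/-- The monomial `a t^n`. -/
noncomputable def monomial (n : ℤ) : A →ₗ[ℂ] TwistedLaurent α hα p hp :=
  (LinearMap.single ℂ (fun _ : ℤ => A) n).codRestrict (laurentSpace p) (single_mem p n)

theorem monomial_mul [IsArensMichaelAlgebra A] (m n : ℤ) (a b : A) :
    (monomial m a * monomial n b : TwistedLaurent α hα p hp) =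
      monomial (m + n) (a * (α.toAlgEquiv ^ m) b) :=
  Subtype.ext (twistedMul_single α m n a b)

theorem monomial_zero_one [IsArensMichaelAlgebra A] :
    (monomial 0 1 : TwistedLaurent α hα p hp) = 1 := rfl

theorem continuous_monomial (n : ℤ) :
    Continuous (monomial n : A →ₗ[ℂ] TwistedLaurent α hα p hp) := by
  have := hp.topologicalAddGroup
  refine withSeminorms.continuous_of_continuous_comp _ fun i => ?_
  have h : ∀ a : A, seminorms i (monomial n a : TwistedLaurent α hα p hp) =
      p i.1 a * (i.2 : ℝ) ^ n := fun a => by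
    refine (tsum_eq_single n fun m hm => ?_).trans ?_
    · change p i.1 ((Pi.single n a : ℤ → A) m) * _ = 0
      rw [Pi.single_eq_of_ne hm, map_zero, zero_mul]
    · change p i.1 ((Pi.single n a : ℤ → A) n) * _ = _
      rw [Pi.single_eq_same]
  refine Continuous.congr ?_ fun a => (h a).symm
  exact (hp.continuous_seminorm i.1).mul continuous_const

variable [IsArensMichaelAlgebra A] (α hα p hp)

/-- The natural inclusion `A → O(ℂ^×, A; α)`. -/
noncomputable def incl : A →A[ℂ] TwistedLaurent α hα p hp where
  toAlgHom := AlgHom.ofLinearMap (monomial 0) rfl fun a b => by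
    rw [monomial_mul, zpow_zero, add_zero]
    rfl
  cont := continuous_monomial 0

/-- The variable `t`. -/
noncomputable def t : TwistedLaurent α hα p hp := monomial 1 1

/-- The inverse variable `t⁻¹`. -/
noncomputable def tInv : TwistedLaurent α hα p hp := monomial (-1) 1

/-- The natural triple `a ↦ a`, `x ↦ x t`, `y ↦ y t⁻¹` with values in `O(ℂ^×, A; α)`. -/
noncomputable def naturalTriple : CompatibleTriple (twistPair α) (TwistedLaurent α hα p hp) where
  θ := incl α hα p hp
  fst := ⟨monomial 1 ∘ₗ (Twist.of α).symm.toLinearMap,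
    (continuous_monomial (A := A) 1).comp (Twist.continuous_of_symm α)⟩
  snd := ⟨monomial (-1) ∘ₗ (Twist.of α.symm).symm.toLinearMap,
    (continuous_monomial (A := A) (-1)).comp (Twist.continuous_of_symm α.symm)⟩
  fst_left a x := (monomial_mul 0 1 a ((Twist.of α).symm x)).symm
  fst_right a x := (monomial_mul 1 0 ((Twist.of α).symm x) a).symm
  snd_left a y := (monomial_mul 0 (-1) a ((Twist.of α.symm).symm y)).symm
  snd_right a y := (monomial_mul (-1) 0 ((Twist.of α.symm).symm y) a).symm
  comm₁ x y := monomial_mul 1 (-1) ((Twist.of α).symm x) ((Twist.of α.symm).symm y)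
  comm₂ y x := monomial_mul (-1) 1 ((Twist.of α.symm).symm y) ((Twist.of α).symm x)

end TwistedLaurent

end Twisted

end AMLaurent

open AMLaurent

universe u v w

/-! For `q` in the localizing family and `D ≥ 1`, put `N_D(f) = ∑ q(a_n) D^|n|` for `f = ∑ a_n t^n`.
These seminorms generate the topology of the Laurent algebra: `ρ^n ≤ D^|n|` once `D` dominates `ρ`
and `ρ⁻¹`, and conversely `D^|n| ≤ D^n + D^(-n)`. They need not be submultiplicative, because moving
`t^n` past a coefficient applies `α^n`, at the price of a factor `C^|n|`. The factor can be charged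
to the left argument alone: `N_D(f g) ≤ N_{CD}(f) N_D(g)` (`absSeminorm_mul_le`). So left
multiplications are bounded for the single seminorm `N_D`, and their operator seminorm `M` is
submultiplicative. It satisfies `M ≤ N_{CD}`, hence is continuous, and `N_D ≤ q(1) M`, as the test
vector `1` shows. Finite suprema of such `M` therefore dominate the generating seminorms, which is
the Arens–Michael property. Completeness is that of a weighted `ℓ¹` space: limits are taken
coefficientwise.

For universality, a compatible triple in `B` makes `u = φ(1)` a unit with inverse `ψ(1)`, and the
bimodule laws give `u θ(a) = θ(α a) u`. A submultiplicative seminorm of `θ(a_n) u^n` grows at most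
like a continuous seminorm of `a_n` times `R^|n|`, so `∑ a_n t^n ↦ ∑ θ(a_n) u^n` converges and is
continuous. Laurent series are sums of their monomials (`hasSum_monomial`), so multiplicativity and
uniqueness need only be checked on monomials. The isomorphism statement is the usual uniqueness of
universal objects. -/

namespace AMLaurent

open Topology MulOpposite

/-! ### Renorming by the operator seminorm of left multiplication -/

section Renorming

variable {V : Type*} [Ring V] [Algebra ℂ V]

/-- The operator seminorm of left multiplications: the least `M` with `N (x * y) ≤ M x * N y`. It
exists because left multiplications are bounded for `N`. -/
noncomputable def leftMulSeminorm (N N' : Seminorm ℂ V) (h : ∀ x y, N (x * y) ≤ N' x * N y) :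
    Seminorm ℂ V :=
  have hbdd : ∀ x, BddBelow {c : ℝ | 0 ≤ c ∧ ∀ y, N (x * y) ≤ c * N y} :=
    fun _ => ⟨0, fun _ hc => hc.1⟩
  have hne : ∀ x, {c : ℝ | 0 ≤ c ∧ ∀ y, N (x * y) ≤ c * N y}.Nonempty :=
    fun x => ⟨N' x, apply_nonneg _ _, h x⟩
  Seminorm.ofSMulLE (fun x => sInf {c : ℝ | 0 ≤ c ∧ ∀ y, N (x * y) ≤ c * N y})
    (le_antisymm (csInf_le (hbdd 0) ⟨le_rfl, fun y => by simp⟩)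
      (le_csInf (hne 0) fun c hc => hc.1))
    (fun x x' => by
      rw [← csInf_add (hne x) (hbdd x) (hne x') (hbdd x')]
      refine csInf_le_csInf (hbdd _) ((hne x).add (hne x')) ?_
      rintro _ ⟨c, hc, c', hc', rfl⟩
      refine ⟨add_nonneg hc.1 hc'.1, fun y => ?_⟩
      rw [add_mul, add_mul]
      exact (map_add_le_add _ _ _).trans (add_le_add (hc.2 y) (hc'.2 y)))
    (fun r x => by
      rw [← smul_eq_mul, ← Real.sInf_smul_of_nonneg (norm_nonneg r)]
      refine csInf_le_csInf (hbdd _) ((hne x).smul_set) ?_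
      rintro _ ⟨c, hc, rfl⟩
      refine ⟨mul_nonneg (norm_nonneg _) hc.1, fun y => ?_⟩
      rw [smul_mul_assoc, map_smul_eq_mul]
      change _ ≤ ‖r‖ * c * N y
      rw [mul_assoc]
      exact mul_le_mul_of_nonneg_left (hc.2 y) (norm_nonneg _))

variable {N N' : Seminorm ℂ V} (h : ∀ x y, N (x * y) ≤ N' x * N y)

theorem leftMulSeminorm_le_of_bound {x : V} {c : ℝ} (hc : 0 ≤ c) (hx : ∀ y, N (x * y) ≤ c * N y) :
    leftMulSeminorm N N' h x ≤ c :=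
  csInf_le ⟨0, fun _ hc => hc.1⟩ ⟨hc, hx⟩

theorem leftMulSeminorm_le : leftMulSeminorm N N' h ≤ N' := fun x =>
  leftMulSeminorm_le_of_bound h (apply_nonneg _ _) (h x)

/-- The infimum is attained: it is itself an admissible bound, which gives submultiplicativity by
composing operators. -/
theorem mul_le_leftMulSeminorm (x y : V) : N (x * y) ≤ leftMulSeminorm N N' h x * N y := by
  -- If `N y = 0`, one cannot divide by it; there the original bound `h` forces `N (x * y) = 0`.
  rcases (apply_nonneg N y).eq_or_lt with hy | hy
  · have := h x y
    rwa [← hy, mul_zero] at this ⊢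
  · rw [← div_le_iff₀ hy]
    exact le_csInf ⟨N' x, apply_nonneg _ _, h x⟩ fun c hc => (div_le_iff₀ hy).2 (hc.2 y)

theorem leftMulSeminorm_mul_le (x y : V) : leftMulSeminorm N N' h (x * y) ≤
    leftMulSeminorm N N' h x * leftMulSeminorm N N' h y := by
  refine leftMulSeminorm_le_of_bound h (mul_nonneg (apply_nonneg _ _) (apply_nonneg _ _)) fun z => ?_
  rw [mul_assoc, mul_assoc]
  exact (mul_le_leftMulSeminorm h x _).trans
    (mul_le_mul_of_nonneg_left (mul_le_leftMulSeminorm h y z) (apply_nonneg _ _))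

/-- Evaluating left multiplication by `x` at the test vector `1` recovers `N x`. Nothing is lost up
to a constant when `N` is replaced by the operator seminorm. -/
theorem le_leftMulSeminorm (x : V) : N x ≤ N 1 * leftMulSeminorm N N' h x := by
  have := mul_le_leftMulSeminorm h x 1
  rwa [mul_one, mul_comm] at this

end Renorming

/-! ### Generating families of seminorms -/

section General

/-- Continuity of the members of `S` bounds them by `P`, so only the domination of each `P i` by a
single member of `S` has to be supplied. It will be applied to the set of all continuous
submultiplicative seminorms. -/
theorem withSeminorms_of_le {V ι : Type*} [AddCommGroup V] [Module ℂ V] [TopologicalSpace V]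
    {P : SeminormFamily ℂ V ι} (hP : WithSeminorms P) {S : Set (Seminorm ℂ V)}
    (hS : ∀ q ∈ S, Continuous q) (hle : ∀ i, ∃ C : NNReal, ∃ q ∈ S, P i ≤ C • q) :
    WithSeminorms (fun q : S => (q : Seminorm ℂ V)) := by
  refine hP.congr (fun q => ?_) fun i => ?_
  · obtain ⟨s, C, -, hC⟩ := Seminorm.bound_of_continuous hP q (hS q q.2)
    exact ⟨s, C, hC⟩
  · obtain ⟨C, q, hq, h⟩ := hle i
    exact ⟨{⟨q, hq⟩}, C, by simpa using h⟩

/-- Needed to replace a bound by finitely many submultiplicative seminorms by a bound by one. -/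
theorem finset_sup_submultiplicative {V ι : Type*} [Ring V] [Algebra ℂ V] (M : ι → Seminorm ℂ V)
    (s : Finset ι) (h : ∀ i ∈ s, ∀ x y, M i (x * y) ≤ M i x * M i y) (x y : V) :
    s.sup M (x * y) ≤ s.sup M x * s.sup M y :=
  Seminorm.finset_sup_apply_le (mul_nonneg (apply_nonneg _ _) (apply_nonneg _ _)) fun i hi =>
    (h i hi x y).trans (mul_le_mul (Seminorm.le_finset_sup_apply hi)
      (Seminorm.le_finset_sup_apply hi) (apply_nonneg _ _) (apply_nonneg _ _))

theorem seminorm_finset_sup_le {V ι : Type*} [AddCommGroup V] [Module ℂ V] (M : ι → Seminorm ℂ V)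
    (s : Finset ι) (x : V) : s.sup M x ≤ ∑ i ∈ s, M i x := by
  refine (Seminorm.finset_sup_le_sum M s x).trans_eq ?_
  rw [← FunLike.coeAddMonoidHom_apply, map_sum, Finset.sum_apply]
  rfl

end General

namespace TwistedLaurent

/-! ### Coefficients, completeness and monomial expansions -/

section Topology

variable {A : Type u} [Ring A] [Algebra ℂ A] [UniformSpace A] {Λ : Type w}
  {α : A ≃A[ℂ] A} {hα : IsMLocalizable (autPair α)} {p : SeminormFamily ℂ A Λ}
  {hp : WithSeminorms p}

/-- The `n`-th coefficient of a Laurent series. -/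
def coeff (n : ℤ) : TwistedLaurent α hα p hp →ₗ[ℂ] A :=
  LinearMap.proj n ∘ₗ (laurentSpace p).subtype

theorem ext_coeff {f g : TwistedLaurent α hα p hp} (h : ∀ n, coeff n f = coeff n g) : f = g :=
  Subtype.ext (funext h)

theorem coeff_monomial (m n : ℤ) (a : A) :
    coeff m (monomial n a : TwistedLaurent α hα p hp) = (Pi.single n a : ℤ → A) m := rfl

theorem coeff_mul [IsArensMichaelAlgebra A] (f g : TwistedLaurent α hα p hp) (n : ℤ) :
    coeff n (f * g) = ∑' i : ℤ, coeff i f * (α.toAlgEquiv ^ i) (coeff (n - i) g) := rfl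

theorem summable_seminorms (f : TwistedLaurent α hα p hp) (i : Λ × {ρ : ℝ // 0 < ρ}) :
    Summable fun n : ℤ => p i.1 (coeff n f) * (i.2 : ℝ) ^ n := f.2 i.1 i.2 i.2.2

theorem seminorms_apply (f : TwistedLaurent α hα p hp) (i : Λ × {ρ : ℝ // 0 < ρ}) :
    seminorms i f = ∑' n : ℤ, p i.1 (coeff n f) * (i.2 : ℝ) ^ n := rfl

theorem continuous_coeff (n : ℤ) :
    Continuous (coeff n : TwistedLaurent α hα p hp →ₗ[ℂ] A) := by
  have := (isUniformAddGroup (α := α) (hα := hα) (p := p) (hp := hp))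
  refine hp.continuous_of_continuous_comp _ fun l => ?_
  -- At radius `1` every weight is `1`, so a single term is bounded by the whole sum.
  refine Seminorm.continuous_of_le
    (withSeminorms.continuous_seminorm (l, (⟨1, one_pos⟩ : {ρ : ℝ // 0 < ρ}))) fun f => ?_
  have h := summable_seminorms f (l, ⟨1, one_pos⟩)
  rw [seminorms_apply]
  simpa using h.le_tsum n fun m _ => by positivity

theorem t2Space [T2Space A] : T2Space (TwistedLaurent α hα p hp) :=
  T2Space.of_injective_continuous (f := fun f (n : ℤ) => coeff n f)
    (fun _ _ h => ext_coeff (congrFun h)) (continuous_pi continuous_coeff)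

/-- The usual argument for weighted `ℓ¹`: a Cauchy filter converges in each coefficient, and its
uniform bounds pass to the limit on finite partial sums, from which they extend to the full series.
-/
theorem completeSpace [CompleteSpace A] [IsUniformAddGroup A] :
    CompleteSpace (TwistedLaurent α hα p hp) := by
  have := (isUniformAddGroup (α := α) (hα := hα) (p := p) (hp := hp))
  refine ⟨fun {F} hF => ?_⟩
  have hF' := hF.1
  have hlim : ∀ n : ℤ, ∃ a : A, F.Tendsto (fun f => coeff n f) (𝓝 a) := fun n =>
    CompleteSpace.complete (hF.map
      (uniformContinuous_addMonoidHom_of_continuous (f := (coeff n).toAddMonoidHom)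
        (continuous_coeff n)))
  choose g hg using hlim
  -- The quantifier over `s` stands inside the "eventually": one set of the filter serves all finite
  -- sums. This gives summability of `f - g` before `g` is known to lie in the space.
  have key : ∀ (i : Λ × {ρ : ℝ // 0 < ρ}) (ε : ℝ), 0 < ε → ∀ᶠ f in F, ∀ s : Finset ℤ,
      ∑ n ∈ s, p i.1 (coeff n f - g n) * (i.2 : ℝ) ^ n ≤ ε := by
    intro i ε hε
    have hρ : 0 < (i.2 : ℝ) := i.2.2
    have hU : {z : TwistedLaurent α hα p hp × TwistedLaurent α hα p hp |
        seminorms i (z.1 - z.2) < ε} ∈ uniformity (TwistedLaurent α hα p hp) := by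
      have hc : Continuous (seminorms (α := α) (hα := hα) (p := p) (hp := hp) i) :=
        withSeminorms.continuous_seminorm i
      have h0 := hc.tendsto 0
      rw [map_zero] at h0
      rw [uniformity_eq_comap_nhds_zero_swapped]
      exact ⟨_, h0.eventually_lt_const hε, fun z hz => hz⟩
    obtain ⟨U, hUF, hUU⟩ := (cauchy_iff.1 hF).2 _ hU
    filter_upwards [hUF] with f hf s
    have hpc := hp.continuous_seminorm i.1
    have ht : F.Tendsto (fun h : TwistedLaurent α hα p hp =>
        ∑ n ∈ s, p i.1 (coeff n f - coeff n h) * (i.2 : ℝ) ^ n)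
        (𝓝 (∑ n ∈ s, p i.1 (coeff n f - g n) * (i.2 : ℝ) ^ n)) :=
      tendsto_finsetSum _ fun n _ =>
        ((hpc.tendsto _).comp (tendsto_const_nhds.sub (hg n))).mul_const _
    -- The seminorm of `f - h` bounds every finite sum for `h` in `U`; letting `h` run along `F`
    -- replaces its coefficients by those of `g`.
    refine le_of_tendsto ht ?_
    filter_upwards [hUF] with h hh
    have h1 : seminorms i (f - h) < ε := hUU (Set.mk_mem_prod hf hh)
    refine le_trans ?_ h1.le
    have h2 := (summable_seminorms (f - h) i).sum_le_tsum s fun n _ => by positivity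
    rw [seminorms_apply]
    simpa only [map_sub] using h2
  -- Write `g = f - (f - g)` with `f` in the space and `f - g` having bounded partial sums.
  have hmem : g ∈ laurentSpace p := by
    intro l ρ hρ
    obtain ⟨f, hf⟩ := (key (l, ⟨ρ, hρ⟩) 1 one_pos).exists
    have h1 : Summable fun n : ℤ => p l (coeff n f - g n) * ρ ^ n :=
      summable_of_sum_le (fun n => by positivity) hf
    refine Summable.of_nonneg_of_le (fun n => by positivity) (fun n => ?_)
      ((summable_seminorms f (l, ⟨ρ, hρ⟩)).add h1)
    rw [← add_mul]
    refine mul_le_mul_of_nonneg_right ?_ (by positivity)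
    have h2 := map_sub_le_add (p l) (coeff n f) (coeff n f - g n)
    rwa [sub_sub_cancel] at h2
  refine ⟨⟨g, hmem⟩, ?_⟩
  refine (withSeminorms.tendsto_nhds (id : TwistedLaurent α hα p hp → _) _).2 fun i ε hε => ?_
  filter_upwards [key i (ε / 2) (half_pos hε)] with f hf
  refine lt_of_le_of_lt ?_ (half_lt_self hε)
  have hρ : 0 < (i.2 : ℝ) := i.2.2
  exact Real.tsum_le_of_sum_le (fun n => by positivity) hf

/-- Removing finitely many monomials leaves a remainder whose seminorm is the tail of a convergent
series of real numbers. -/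
theorem hasSum_monomial (f : TwistedLaurent α hα p hp) :
    HasSum (fun n : ℤ => monomial n (coeff n f)) f := by
  refine (withSeminorms.tendsto_nhds _ _).2 fun i ε hε => ?_
  have hρ : 0 < (i.2 : ℝ) := i.2.2
  have h := tendsto_tsum_compl_atTop_zero fun n : ℤ => p i.1 (coeff n f) * (i.2 : ℝ) ^ n
  rw [SummationFilter.unconditional_filter]
  filter_upwards [h.eventually_lt_const hε] with s hs
  refine lt_of_eq_of_lt ?_ hs
  rw [map_sub_rev, seminorms_apply]
  refine Eq.trans (tsum_congr fun n => ?_)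
    (tsum_subtype {n : ℤ | n ∉ s} fun n => p i.1 (coeff n f) * (i.2 : ℝ) ^ n).symm
  rw [map_sub, map_sum]
  simp only [coeff_monomial, Finset.sum_pi_single]
  by_cases hn : n ∈ s <;> simp [hn]

/-- Density principle behind both multiplicativity of the lift and its uniqueness. -/
theorem ext_monomial {E : Type*} [AddCommGroup E] [Module ℂ E] [TopologicalSpace E] [T2Space E]
    {F G : TwistedLaurent α hα p hp →L[ℂ] E} (h : ∀ n a, F (monomial n a) = G (monomial n a)) :
    F = G := by
  ext f
  have h1 := (hasSum_monomial f).mapL F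
  have h2 := (hasSum_monomial f).mapL G
  simp only [h] at h1
  exact h1.unique h2

end Topology

/-! ### Submultiplicative seminorms on the twisted Laurent algebra -/

section ArensMichael

variable {A : Type u} [Ring A] [Algebra ℂ A] [UniformSpace A] {Λ : Type w}
  {α : A ≃A[ℂ] A} {hα : IsMLocalizable (autPair α)} {p : SeminormFamily ℂ A Λ}
  {hp : WithSeminorms p}

/-- The seminorm `∑ a_n t^n ↦ ∑ q (a_n) D^|n|` attached to a continuous seminorm `q`. -/
noncomputable def absSeminorm (q : Seminorm ℂ A) (hq : Continuous q) {D : ℝ} (hD : 0 < D) :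
    Seminorm ℂ (TwistedLaurent α hα p hp) :=
  Seminorm.of (fun f => ∑' n : ℤ, q (coeff n f) * D ^ n.natAbs)
    (fun f g => by
      have hf := summable_natAbs hp f.2 q hq hD
      have hg := summable_natAbs hp g.2 q hq hD
      refine le_trans ((summable_natAbs hp (f + g).2 q hq hD).tsum_le_tsum (fun n => ?_)
        (hf.add hg)) (hf.tsum_add hg).le
      rw [← add_mul]
      exact mul_le_mul_of_nonneg_right (map_add_le_add _ _ _) (by positivity))
    (fun c f => by
      rw [← tsum_mul_left]
      exact tsum_congr fun n => by rw [map_smul, map_smul_eq_mul, mul_assoc])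

theorem summable_absSeminorm {q : Seminorm ℂ A} (hq : Continuous q) {D : ℝ} (hD : 0 < D)
    (f : TwistedLaurent α hα p hp) :
    Summable fun n : ℤ => q (coeff n f) * D ^ n.natAbs := summable_natAbs hp f.2 q hq hD

variable {q : Seminorm ℂ A} (hq : Continuous q) {D : ℝ} (hD : 0 < D)

theorem absSeminorm_apply (f : TwistedLaurent α hα p hp) :
    absSeminorm q hq hD f = ∑' n : ℤ, q (coeff n f) * D ^ n.natAbs := rfl

theorem absSeminorm_one [IsArensMichaelAlgebra A] :
    absSeminorm q hq hD (1 : TwistedLaurent α hα p hp) = q 1 := by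
  rw [absSeminorm_apply, tsum_eq_single 0]
  · simp [← monomial_zero_one, coeff_monomial]
  · intro n hn
    simp [← monomial_zero_one, coeff_monomial, hn]

/-- Since `D^|n| ≤ D^n + D⁻¹^n`, the defining seminorms at the two radii `D` and `D⁻¹` suffice. -/
theorem continuous_absSeminorm :
    Continuous (absSeminorm q hq hD : Seminorm ℂ (TwistedLaurent α hα p hp)) := by
  have := (isUniformAddGroup (α := α) (hα := hα) (p := p) (hp := hp))
  obtain ⟨s, C, -, hC⟩ := Seminorm.bound_of_continuous hp q hq
  let i₁ : Λ → Λ × {ρ : ℝ // 0 < ρ} := fun l => (l, ⟨D, hD⟩)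
  let i₂ : Λ → Λ × {ρ : ℝ // 0 < ρ} := fun l => (l, ⟨D⁻¹, inv_pos.2 hD⟩)
  have hc : Continuous (∑ l ∈ s, C • (seminorms (i₁ l) + seminorms (i₂ l)) :
      Seminorm ℂ (TwistedLaurent α hα p hp)) := by
    have h : Continuous fun f : TwistedLaurent α hα p hp =>
        ∑ l ∈ s, (C : ℝ) * (seminorms (i₁ l) f + seminorms (i₂ l) f) :=
      continuous_finsetSum _ fun l _ => continuous_const.mul
        ((withSeminorms.continuous_seminorm (i₁ l)).add
          (withSeminorms.continuous_seminorm (i₂ l)))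
    refine h.congr fun f => ?_
    rw [← FunLike.coeAddMonoidHom_apply, map_sum, Finset.sum_apply]
    rfl
  refine Seminorm.continuous_of_le hc fun f => ?_
  have hs : ∀ l, HasSum (fun n : ℤ => (C : ℝ) * (p l (coeff n f) * D ^ n +
      p l (coeff n f) * D⁻¹ ^ n)) (C * (seminorms (i₁ l) f + seminorms (i₂ l) f)) := fun l =>
    ((summable_seminorms f (i₁ l)).hasSum.add (summable_seminorms f (i₂ l)).hasSum).mul_left _
  have hs' := hasSum_sum fun l (_ : l ∈ s) => hs l
  rw [← FunLike.coeAddMonoidHom_apply (∑ l ∈ s, _), map_sum, Finset.sum_apply]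
  refine hasSum_le (fun n => ?_) (summable_absSeminorm hq hD f).hasSum hs'
  simp only [← mul_add, ← mul_assoc]
  rw [← Finset.sum_mul, ← Finset.mul_sum]
  exact mul_le_mul ((hC _).trans (mul_le_mul_of_nonneg_left (seminorm_finset_sup_le _ _ _) C.2))
    (natAbs_pow_le_zpow hD n) (by positivity)
    (mul_nonneg C.2 (Finset.sum_nonneg fun _ _ => apply_nonneg _ _))

/-- In `a_i α^i(b_{n-i})` the automorphism costs `C^|i|`, which is absorbed into the weight of
`a_i`. The weight of `g` stays `D` on both sides, and this asymmetry is what permits renorming by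
left multiplications. -/
theorem absSeminorm_mul_le [IsArensMichaelAlgebra A] (hm : ∀ a b : A, q (a * b) ≤ q a * q b)
    {C : ℝ} (hC : 1 ≤ C) (hαC : ∀ (n : ℤ) (a : A), q ((α.toAlgEquiv ^ n) a) ≤ C ^ n.natAbs * q a)
    (hD1 : 1 ≤ D) (f g : TwistedLaurent α hα p hp) :
    absSeminorm q hq hD (f * g) ≤
      absSeminorm q hq (mul_pos (zero_lt_one.trans_le hC) hD) f * absSeminorm q hq hD g := by
  have hC0 : 0 < C := zero_lt_one.trans_le hC
  have hf := summable_absSeminorm hq (mul_pos hC0 hD) f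
  have hg := summable_absSeminorm hq hD g
  have hfg := hf.mul_of_nonneg hg (fun n => by positivity) (fun n => by positivity)
  have haux : Summable fun z : ℤ × ℤ =>
      q (coeff z.1 f * (α.toAlgEquiv ^ z.1) (coeff (z.2 - z.1) g)) * D ^ z.2.natAbs :=
    summable_mul_aux α hp hq hm hC hαC f.2 g.2 hD1
  -- Weight `1` gives the unweighted summability over `i` needed to move `q` inside the sum defining
  -- a coefficient.
  have haux1 : Summable fun z : ℤ × ℤ =>
      q (coeff z.1 f * (α.toAlgEquiv ^ z.1) (coeff (z.2 - z.1) g)) * (1 : ℝ) ^ z.2.natAbs :=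
    summable_mul_aux α hp hq hm hC hαC f.2 g.2 le_rfl
  -- The shear `(i, n) ↦ (i, n - i)` turns the convolution into a product of two independent sums.
  let e : ℤ × ℤ ≃ ℤ × ℤ :=
    { toFun := fun z => (z.1, z.2 - z.1)
      invFun := fun z => (z.1, z.2 + z.1)
      left_inv := fun z => by simp
      right_inv := fun z => by simp }
  calc absSeminorm q hq hD (f * g)
      ≤ ∑' n : ℤ, ∑' i : ℤ,
          q (coeff i f * (α.toAlgEquiv ^ i) (coeff (n - i) g)) * D ^ n.natAbs := by
        refine (summable_absSeminorm hq hD (f * g)).tsum_le_tsum (fun n => ?_) haux.prod_symm.prod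
        rw [tsum_mul_right, coeff_mul]
        refine mul_le_mul_of_nonneg_right (seminorm_tsum_le q hq (summable_mul hα hp f.2 g.2 n) ?_)
          (by positivity)
        simpa using haux1.prod_symm.prod_factor n
    _ = ∑' z : ℤ × ℤ,
          q (coeff z.1 f * (α.toAlgEquiv ^ z.1) (coeff (z.2 - z.1) g)) * D ^ z.2.natAbs := by
        rw [haux.tsum_prod]
        exact haux.tsum_comm
    _ ≤ ∑' z : ℤ × ℤ, q (coeff z.1 f) * (C * D) ^ z.1.natAbs *
          (q (coeff z.2 g) * D ^ z.2.natAbs) := by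
        rw [← e.tsum_eq fun z : ℤ × ℤ => q (coeff z.1 f) * (C * D) ^ z.1.natAbs *
          (q (coeff z.2 g) * D ^ z.2.natAbs)]
        refine haux.tsum_le_tsum (fun z => ?_) (e.summable_iff.2 hfg)
        change _ ≤ q (coeff z.1 f) * (C * D) ^ z.1.natAbs *
          (q (coeff (z.2 - z.1) g) * D ^ (z.2 - z.1).natAbs)
        -- This is `|n| ≤ |i| + |n - i|`; `D ≥ 1` makes powers monotone in the exponent.
        have h2 : D ^ z.2.natAbs ≤ D ^ z.1.natAbs * D ^ (z.2 - z.1).natAbs := by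
          rw [← pow_add]
          exact pow_le_pow_right₀ hD1 (by omega)
        have h3 : q (coeff z.1 f * (α.toAlgEquiv ^ z.1) (coeff (z.2 - z.1) g)) ≤
            q (coeff z.1 f) * (C ^ z.1.natAbs * q (coeff (z.2 - z.1) g)) :=
          (hm _ _).trans (mul_le_mul_of_nonneg_left (hαC _ _) (apply_nonneg _ _))
        refine (mul_le_mul h3 h2 (by positivity) (by positivity)).trans_eq ?_
        rw [mul_pow]
        ring
    _ = _ := (hf.tsum_mul_tsum hg hfg).symm

/-- Every `absSeminorm` of a submultiplicative seminorm that is compatible with `α` is dominated by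
a continuous submultiplicative seminorm. -/
theorem exists_submultiplicative_ge [IsArensMichaelAlgebra A]
    (hm : ∀ a b : A, q (a * b) ≤ q a * q b)
    {C : ℝ} (hC : 1 ≤ C) (hαC : ∀ (n : ℤ) (a : A), q ((α.toAlgEquiv ^ n) a) ≤ C ^ n.natAbs * q a)
    (hD1 : 1 ≤ D) : ∃ M : Seminorm ℂ (TwistedLaurent α hα p hp), Continuous M ∧
      (∀ f g, M (f * g) ≤ M f * M g) ∧ ∀ f, absSeminorm q hq hD f ≤ q 1 * M f := by
  have := (isUniformAddGroup (α := α) (hα := hα) (p := p) (hp := hp))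
  have h := absSeminorm_mul_le (hα := hα) (p := p) (hp := hp) hq hD hm hC hαC hD1
  -- Here `N` has weight `D` and `N'` has weight `C * D`; continuity comes from `M ≤ N'`, the lower
  -- bound from the value `q 1` of `N` at `1`.
  refine ⟨leftMulSeminorm _ _ h, Seminorm.continuous_of_le (continuous_absSeminorm hq _)
    (leftMulSeminorm_le h), leftMulSeminorm_mul_le h, fun f => ?_⟩
  have := le_leftMulSeminorm h f
  rwa [absSeminorm_one] at this

variable (α hα p hp) in
theorem isArensMichaelAlgebra [IsArensMichaelAlgebra A] :
    IsArensMichaelAlgebra (TwistedLaurent α hα p hp) where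
  toIsUniformAddGroup := isUniformAddGroup
  toCompleteSpace := completeSpace
  toT2Space := t2Space
  exists_submultiplicative := by
    refine ⟨{M | Continuous M ∧ ∀ f g, M (f * g) ≤ M f * M g},
      withSeminorms_of_le withSeminorms (fun M hM => hM.1) fun i => ?_, fun M hM => hM.2⟩
    have := (isUniformAddGroup (α := α) (hα := hα) (p := p) (hp := hp))
    obtain ⟨S, hS, hm, hloc⟩ := id hα
    have hρ : 0 < (i.2 : ℝ) := i.2.2
    -- The weight dominates `ρ` and `ρ⁻¹`, so that `ρ^n ≤ D^|n|`, and also `1`, as the product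
    -- estimate requires.
    have hDpos : 0 < max (max (i.2 : ℝ) (i.2 : ℝ)⁻¹) 1 := lt_max_of_lt_right one_pos
    have hSc : ∀ q : S, Continuous (q : Seminorm ℂ A) := hS.continuous_seminorm
    have hM : ∀ q : S, ∃ M : Seminorm ℂ (TwistedLaurent α hα p hp), Continuous M ∧
        (∀ f g, M (f * g) ≤ M f * M g) ∧
          ∀ f, absSeminorm (q : Seminorm ℂ A) (hSc q) hDpos f ≤ (q : Seminorm ℂ A) 1 * M f := by
      intro q
      obtain ⟨C, hC, hC'⟩ := exists_const α hloc q.2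
      exact exists_submultiplicative_ge (hSc q) hDpos (hm q q.2) hC hC' (le_max_right _ _)
    choose M hMc hMm hMle using hM
    obtain ⟨s, C, -, hC⟩ := Seminorm.bound_of_continuous hS (p i.1) (hp.continuous_seminorm i.1)
    have hK : 0 ≤ ∑ q ∈ s, (q : Seminorm ℂ A) 1 := Finset.sum_nonneg fun _ _ => apply_nonneg _ _
    -- Here `p i.1 ≤ C • s.sup q`, and each `q` in `s` contributes a factor `q 1` from `hMle`;
    -- adding up gives the constant.
    refine ⟨C * ⟨_, hK⟩, s.sup M, ⟨Seminorm.continuous_finsetSup fun q _ => hMc q,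
      finset_sup_submultiplicative M s fun q _ => hMm q⟩, fun f => ?_⟩
    have h1 : HasSum (fun n : ℤ => (C : ℝ) * ∑ q ∈ s, (q : Seminorm ℂ A) (coeff n f) *
        max (max (i.2 : ℝ) (i.2 : ℝ)⁻¹) 1 ^ n.natAbs)
        (C * ∑ q ∈ s, absSeminorm (q : Seminorm ℂ A) (hSc q) hDpos f) :=
      (hasSum_sum fun q _ => (summable_absSeminorm (hSc q) hDpos f).hasSum).mul_left _
    have h2 : seminorms i f ≤ C * ∑ q ∈ s, absSeminorm (q : Seminorm ℂ A) (hSc q) hDpos f := by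
      refine hasSum_le (fun n => ?_) (summable_seminorms f i).hasSum h1
      rw [← Finset.sum_mul, ← mul_assoc]
      exact mul_le_mul ((hC _).trans (mul_le_mul_of_nonneg_left (seminorm_finset_sup_le _ _ _) C.2))
        (zpow_le_natAbs_pow hρ ((le_max_left _ _).trans (le_max_left _ _))
          ((le_max_right _ _).trans (le_max_left _ _)) n) (by positivity)
        (mul_nonneg C.2 (Finset.sum_nonneg fun _ _ => apply_nonneg _ _))
    refine h2.trans ?_
    change _ ≤ ((C : ℝ) * ∑ q ∈ s, (q : Seminorm ℂ A) 1) * s.sup M f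
    rw [mul_assoc, Finset.sum_mul]
    refine mul_le_mul_of_nonneg_left (Finset.sum_le_sum fun q hq => (hMle q f).trans ?_) C.2
    exact mul_le_mul_of_nonneg_left (Seminorm.le_finset_sup_apply hq) (apply_nonneg _ _)

end ArensMichael

end TwistedLaurent

/-! ### The homomorphism induced by a compatible triple, and universality -/

section Triples

/-- The factor `b` is kept on the left so that the case `n = 0` is an equality: `q 1` may exceed
`1`, and `q (u ^ n) ≤ R ^ |n|` alone could fail there. -/
theorem seminorm_mul_zpow_le {B : Type*} [Ring B] [Algebra ℂ B] {q : Seminorm ℂ B}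
    (hm : ∀ a b : B, q (a * b) ≤ q a * q b) (u : Bˣ)
    {R : ℝ} (h1 : q u ≤ R) (h2 : q (u⁻¹ : Bˣ) ≤ R) (b : B) (n : ℤ) :
    q (b * (u ^ n : Bˣ)) ≤ q b * R ^ n.natAbs := by
  have hR : 0 ≤ R := (apply_nonneg _ _).trans h1
  have key : ∀ v : Bˣ, q v ≤ R → ∀ k : ℕ, q (b * (v ^ k : Bˣ)) ≤ q b * R ^ k := by
    intro v hv k
    induction k with
    | zero => simp
    | succ k ih =>
      rw [pow_succ, pow_succ, Units.val_mul, ← mul_assoc, ← mul_assoc]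
      exact (hm _ _).trans (mul_le_mul ih hv (apply_nonneg _ _)
        (mul_nonneg (apply_nonneg _ _) (pow_nonneg hR _)))
  obtain ⟨k, rfl | rfl⟩ := n.eq_nat_or_neg
  · simpa using key u h1 k
  · simpa using key u⁻¹ h2 k

variable {A : Type u} [Ring A] [Algebra ℂ A] [UniformSpace A] [IsArensMichaelAlgebra A]
  {α : A ≃A[ℂ] A}

namespace CompatibleTriple

variable {B : Type v} [Ring B] [Algebra ℂ B] [UniformSpace B]
  (T : CompatibleTriple (twistPair α) B)

theorem fst_of (x : A) : T.fst (Twist.of α x) = T.θ x * T.fst (Twist.of α 1) := by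
  rw [← T.fst_left, Twist.smul_of, mul_one]

theorem snd_of (y : A) : T.snd (Twist.of α.symm y) = T.θ y * T.snd (Twist.of α.symm 1) := by
  rw [← T.snd_left, Twist.smul_of, mul_one]

/-- The image of the variable `t`, as a unit. -/
def unit : Bˣ where
  val := T.fst (Twist.of α 1)
  inv := T.snd (Twist.of α.symm 1)
  val_inv := by
    rw [T.comm₁]
    change T.θ (1 * α 1) = 1
    rw [map_one, mul_one, map_one]
  inv_val := by
    rw [T.comm₂]
    change T.θ (1 * α.symm 1) = 1
    rw [map_one, mul_one, map_one]

/-- In `A_α` the right action of `a` on `1` equals the left action of `α a` on `1`; the bimodule map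
transports this identity to `B`. -/
theorem unit_mul (a : A) : (T.unit : B) * T.θ a = T.θ (α a) * T.unit := by
  change T.fst _ * _ = _ * T.fst _
  rw [← T.fst_right, Twist.op_smul_of, one_mul, fst_of]

theorem unit_inv_mul (a : A) :
    ((T.unit⁻¹ : Bˣ) : B) * T.θ a = T.θ (α.symm a) * ((T.unit⁻¹ : Bˣ) : B) := by
  change T.snd _ * _ = _ * T.snd _
  rw [← T.snd_right, Twist.op_smul_of, one_mul, snd_of]

theorem unit_zpow_mul (n : ℤ) (a : A) :
    ((T.unit ^ n : Bˣ) : B) * T.θ a = T.θ ((α.toAlgEquiv ^ n) a) * ((T.unit ^ n : Bˣ) : B) := by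
  induction n generalizing a with
  | zero => simp
  | succ k ih =>
    rw [zpow_add_one, zpow_add_one, Units.val_mul, mul_assoc, unit_mul, ← mul_assoc, ih, mul_assoc]
    rfl
  | pred k ih =>
    rw [zpow_sub_one, zpow_sub_one, Units.val_mul, mul_assoc, unit_inv_mul, ← mul_assoc, ih,
      mul_assoc]
    rfl

variable {Λ : Type w} {hα : IsMLocalizable (autPair α)} {p : SeminormFamily ℂ A Λ}
  {hp : WithSeminorms p}

/-- A continuous submultiplicative seminorm of the terms `θ (a_n) u ^ n` is controlled by a
continuous seminorm of the coefficients. -/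
theorem exists_seminorm_term_le {q : Seminorm ℂ B} (hq : Continuous q)
    (hm : ∀ a b : B, q (a * b) ≤ q a * q b) :
    ∃ r : Seminorm ℂ A, Continuous r ∧ ∃ R : ℝ, 0 < R ∧ ∀ (n : ℤ) (a : A),
      q (T.θ a * (T.unit ^ n : Bˣ)) ≤ r a * R ^ n.natAbs :=
  ⟨q.comp T.θ.toContinuousLinearMap.toLinearMap, hq.comp T.θ.toContinuousLinearMap.continuous,
    -- The `1` only guarantees a positive weight, as `absSeminorm` demands.
    max (max (q T.unit) (q (T.unit⁻¹ : Bˣ))) 1, lt_max_of_lt_right one_pos, fun n a =>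
    seminorm_mul_zpow_le hm T.unit ((le_max_left _ _).trans (le_max_left _ _))
      ((le_max_right _ _).trans (le_max_left _ _)) (T.θ a) n⟩

variable [IsArensMichaelAlgebra B]

theorem summable_lift (f : TwistedLaurent α hα p hp) :
    Summable fun n : ℤ => T.θ (TwistedLaurent.coeff n f) * ((T.unit ^ n : Bˣ) : B) := by
  obtain ⟨S, hS, hm⟩ := IsArensMichaelAlgebra.exists_submultiplicative (A := B)
  refine summable_of_seminorms hS _ fun q hq => ?_
  obtain ⟨r, hr, R, hR, h⟩ := T.exists_seminorm_term_le (hS.continuous_seminorm ⟨q, hq⟩) (hm q hq)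
  exact Summable.of_nonneg_of_le (fun n => apply_nonneg _ _) (fun n => h n _)
    (TwistedLaurent.summable_absSeminorm hr hR f)

/-- The linear map `∑ a_n t^n ↦ ∑ θ (a_n) u ^ n`. -/
noncomputable def liftLinearMap : TwistedLaurent α hα p hp →ₗ[ℂ] B where
  toFun f := ∑' n : ℤ, T.θ (TwistedLaurent.coeff n f) * ((T.unit ^ n : Bˣ) : B)
  map_add' f g := by
    rw [← (T.summable_lift f).tsum_add (T.summable_lift g)]
    exact tsum_congr fun n => by rw [map_add, map_add, add_mul]
  map_smul' c f := by
    obtain ⟨S, hS, -⟩ := IsArensMichaelAlgebra.exists_submultiplicative (A := B)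
    have := hS.continuousSMul
    rw [RingHom.id_apply, ← (T.summable_lift f).tsum_const_smul]
    exact tsum_congr fun n => by rw [map_smul, map_smul, smul_mul_assoc]

/-- The termwise bound that yields convergence also dominates each seminorm of the image by an
`absSeminorm`, which is continuous. -/
theorem continuous_liftLinearMap :
    Continuous (T.liftLinearMap : TwistedLaurent α hα p hp →ₗ[ℂ] B) := by
  have := (TwistedLaurent.isUniformAddGroup (α := α) (hα := hα) (p := p) (hp := hp))
  obtain ⟨S, hS, hm⟩ := IsArensMichaelAlgebra.exists_submultiplicative (A := B)
  refine hS.continuous_of_continuous_comp _ fun q => ?_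
  have hqc : Continuous (q : Seminorm ℂ B) := hS.continuous_seminorm q
  obtain ⟨r, hr, R, hR, h⟩ := T.exists_seminorm_term_le hqc (hm q q.2)
  refine Seminorm.continuous_of_le (TwistedLaurent.continuous_absSeminorm hr hR) fun f => ?_
  have hs := TwistedLaurent.summable_absSeminorm hr hR f
  have hs' := Summable.of_nonneg_of_le (fun n => apply_nonneg _ _) (fun n => h n _) hs
  exact (seminorm_tsum_le (q : Seminorm ℂ B) hqc (T.summable_lift f) hs').trans
    (hs'.tsum_le_tsum (fun n => h n _) hs)

/-- The continuous linear map `∑ a_n t^n ↦ ∑ θ (a_n) u ^ n`. -/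
noncomputable def liftLinear : TwistedLaurent α hα p hp →L[ℂ] B :=
  ⟨T.liftLinearMap, T.continuous_liftLinearMap⟩

theorem liftLinear_monomial (n : ℤ) (a : A) :
    T.liftLinear (TwistedLaurent.monomial n a : TwistedLaurent α hα p hp) =
      T.θ a * ((T.unit ^ n : Bˣ) : B) := by
  change ∑' m : ℤ, T.θ (TwistedLaurent.coeff m _) * _ = _
  rw [tsum_eq_single n]
  · rw [TwistedLaurent.coeff_monomial, Pi.single_eq_same]
  · intro m hmn
    rw [TwistedLaurent.coeff_monomial, Pi.single_eq_of_ne hmn, map_zero, zero_mul]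

theorem liftLinear_monomial_mul (m n : ℤ) (a b : A) :
    T.liftLinear (TwistedLaurent.monomial m a * TwistedLaurent.monomial n b :
      TwistedLaurent α hα p hp) =
      T.liftLinear (TwistedLaurent.monomial m a : TwistedLaurent α hα p hp) *
        T.liftLinear (TwistedLaurent.monomial n b : TwistedLaurent α hα p hp) := by
  rw [TwistedLaurent.monomial_mul, liftLinear_monomial, liftLinear_monomial, liftLinear_monomial,
    map_mul, zpow_add, Units.val_mul, mul_assoc, mul_assoc, ← mul_assoc _ (T.θ b), unit_zpow_mul,
    mul_assoc]

/-- Both sides are continuous and linear in each variable, multiplication in the Laurent algebra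
being continuous by its Arens–Michael property. Density of monomials is used twice: in the right
factor with a monomial on the left, then in the left factor. -/
theorem liftLinear_mul (f g : TwistedLaurent α hα p hp) :
    T.liftLinear (f * g) = T.liftLinear f * T.liftLinear g := by
  have hV := TwistedLaurent.isArensMichaelAlgebra α hα p hp
  have hVm : ContinuousMul (TwistedLaurent α hα p hp) := IsArensMichaelAlgebra.continuousMul
  have hBm : ContinuousMul B := IsArensMichaelAlgebra.continuousMul
  have h1 : ∀ (m : ℤ) (a : A) (g : TwistedLaurent α hα p hp),
      T.liftLinear (TwistedLaurent.monomial m a * g) =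
        T.liftLinear (TwistedLaurent.monomial m a : TwistedLaurent α hα p hp) * T.liftLinear g := by
    intro m a g
    let F : TwistedLaurent α hα p hp →L[ℂ] B :=
      ⟨T.liftLinear.toLinearMap ∘ₗ LinearMap.mulLeft ℂ (TwistedLaurent.monomial m a),
        T.liftLinear.continuous.comp (continuous_const_mul _)⟩
    let G : TwistedLaurent α hα p hp →L[ℂ] B :=
      ⟨LinearMap.mulLeft ℂ (T.liftLinear (TwistedLaurent.monomial m a :
          TwistedLaurent α hα p hp)) ∘ₗ T.liftLinear.toLinearMap,
        (continuous_const_mul _).comp T.liftLinear.continuous⟩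
    have h : F = G := TwistedLaurent.ext_monomial fun n b => T.liftLinear_monomial_mul m n a b
    exact congrArg (fun H => H g) h
  let F : TwistedLaurent α hα p hp →L[ℂ] B :=
    ⟨T.liftLinear.toLinearMap ∘ₗ LinearMap.mulRight ℂ g,
      T.liftLinear.continuous.comp (continuous_mul_const _)⟩
  let G : TwistedLaurent α hα p hp →L[ℂ] B :=
    ⟨LinearMap.mulRight ℂ (T.liftLinear g) ∘ₗ T.liftLinear.toLinearMap,
      (continuous_mul_const _).comp T.liftLinear.continuous⟩
  have h : F = G := TwistedLaurent.ext_monomial fun n b => h1 n b g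
  exact congrArg (fun H => H f) h

/-- The continuous algebra homomorphism `∑ a_n t^n ↦ ∑ θ (a_n) u ^ n`. -/
noncomputable def lift : TwistedLaurent α hα p hp →A[ℂ] B where
  toAlgHom := AlgHom.ofLinearMap T.liftLinear.toLinearMap
    (by
      change T.liftLinear (TwistedLaurent.monomial 0 1 : TwistedLaurent α hα p hp) = 1
      rw [liftLinear_monomial]
      simp)
    T.liftLinear_mul
  cont := T.liftLinear.continuous

theorem lift_monomial (n : ℤ) (a : A) :
    T.lift (TwistedLaurent.monomial n a : TwistedLaurent α hα p hp) =
      T.θ a * ((T.unit ^ n : Bˣ) : B) := T.liftLinear_monomial n a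

end CompatibleTriple

namespace TwistedLaurent

variable {Λ : Type w} (hα : IsMLocalizable (autPair α)) (p : SeminormFamily ℂ A Λ)
  (hp : WithSeminorms p)

theorem t_mul_tInv : t α hα p hp * tInv α hα p hp = 1 := by
  rw [t, tInv, monomial_mul, map_one, mul_one]
  rfl

theorem tInv_mul_t : tInv α hα p hp * t α hα p hp = 1 := by
  rw [t, tInv, monomial_mul, map_one, mul_one]
  rfl

theorem t_mul_incl (a : A) : t α hα p hp * incl α hα p hp a = incl α hα p hp (α a) * t α hα p hp := by
  refine (monomial_mul 1 0 1 a).trans (Eq.trans ?_ (monomial_mul 0 1 (α a) 1).symm)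
  rw [map_one, mul_one, one_mul, zpow_one]
  rfl

theorem tInv_mul_incl (a : A) :
    tInv α hα p hp * incl α hα p hp a = incl α hα p hp (α.symm a) * tInv α hα p hp := by
  refine (monomial_mul (-1) 0 1 a).trans (Eq.trans ?_ (monomial_mul 0 (-1) (α.symm a) 1).symm)
  rw [map_one, mul_one, one_mul, zpow_neg_one]
  rfl

theorem monomial_natCast (k : ℕ) (a : A) :
    (monomial k a : TwistedLaurent α hα p hp) = incl α hα p hp a * t α hα p hp ^ k := by
  induction k with
  | zero => exact (mul_one _).symm
  | succ k ih =>
    rw [pow_succ, ← mul_assoc, ← ih, t, monomial_mul, map_one, mul_one]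
    rfl

theorem monomial_neg_natCast (k : ℕ) (a : A) :
    (monomial (-(k : ℤ)) a : TwistedLaurent α hα p hp) =
      incl α hα p hp a * tInv α hα p hp ^ k := by
  induction k with
  | zero => exact (mul_one _).symm
  | succ k ih =>
    rw [pow_succ, ← mul_assoc, ← ih, tInv, monomial_mul, map_one, mul_one, Nat.cast_add, Nat.cast_one,
      neg_add]

/-- Continuous homomorphisms out of `O(ℂ^×, A; α)` are determined by their values on `A`, `t` and
`t⁻¹`. -/
theorem algHom_ext {B : Type*} [Ring B] [Algebra ℂ B] [TopologicalSpace B] [T2Space B]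
    {F G : TwistedLaurent α hα p hp →A[ℂ] B}
    (h : ∀ a, F (incl α hα p hp a) = G (incl α hα p hp a))
    (ht : F (t α hα p hp) = G (t α hα p hp)) (ht' : F (tInv α hα p hp) = G (tInv α hα p hp)) :
    F = G := by
  have key : F.toContinuousLinearMap = G.toContinuousLinearMap := by
    refine ext_monomial fun n a => ?_
    change F _ = G _
    obtain ⟨k, rfl | rfl⟩ := n.eq_nat_or_neg
    · rw [monomial_natCast, map_mul, map_mul, map_pow, map_pow, h, ht]
    · rw [monomial_neg_natCast, map_mul, map_mul, map_pow, map_pow, h, ht']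
  ext x
  exact congrArg (fun H => H x) key

theorem isTopLaurentTensorAlgebra :
    IsTopLaurentTensorAlgebra.{u, v, u} (naturalTriple α hα p hp) where
  isArensMichael := isArensMichaelAlgebra α hα p hp
  universal B _ _ _ _ T := by
    refine ⟨T.lift, ⟨fun a => ?_, fun x => ?_, fun y => ?_⟩, ?_⟩
    · refine (T.lift_monomial 0 a).trans ?_
      simp
    · refine (T.lift_monomial 1 ((Twist.of α).symm x)).trans ?_
      rw [zpow_one]
      exact (T.fst_of _).symm
    · refine (T.lift_monomial (-1) ((Twist.of α.symm).symm y)).trans ?_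
      rw [zpow_neg_one]
      exact (T.snd_of _).symm
    -- The values at `1 ∈ A_α` and `1 ∈ A_{α⁻¹}` already determine `F` on `t` and `t⁻¹`.
    · rintro F ⟨h, h1, h2⟩
      refine algHom_ext hα p hp (fun a => (h a).trans ?_) ((h1 (Twist.of α 1)).trans ?_)
        ((h2 (Twist.of α.symm 1)).trans ?_)
      · refine Eq.trans ?_ (T.lift_monomial 0 a).symm
        simp
      · refine Eq.trans ?_ (T.lift_monomial 1 1).symm
        rw [zpow_one]
        exact T.fst_of 1
      · refine Eq.trans ?_ (T.lift_monomial (-1) 1).symm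
        rw [zpow_neg_one]
        exact T.snd_of 1

end TwistedLaurent

/-- Universal triples are unique up to a unique topological isomorphism. -/
theorem IsTopLaurentTensorAlgebra.existsUnique_equiv {L L' : Type u} [Ring L] [Algebra ℂ L]
    [UniformSpace L] [Ring L'] [Algebra ℂ L'] [UniformSpace L']
    {T : CompatibleTriple (twistPair α) L} {T' : CompatibleTriple (twistPair α) L'}
    (hT : IsTopLaurentTensorAlgebra.{u, u, u} T) (hT' : IsTopLaurentTensorAlgebra.{u, u, u} T') :
    ∃! e : L ≃A[ℂ] L', (∀ a : A, e (T.θ a) = T'.θ a) ∧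
      e (T.fst (Twist.of α 1)) = T'.fst (Twist.of α 1) ∧
      e (T.snd (Twist.of α.symm 1)) = T'.snd (Twist.of α.symm 1) := by
  have := hT.isArensMichael
  have := hT'.isArensMichael
  obtain ⟨f, ⟨hf, hf1, hf2⟩, hfu⟩ := hT.universal L' T'
  obtain ⟨g, ⟨hg, hg1, hg2⟩, -⟩ := hT'.universal L T
  -- Both `g ∘ f` and the identity carry `T` to itself; similarly for `f ∘ g` and `T'`.
  have hgf : g.comp f = ContinuousAlgHom.id ℂ L :=
    (hT.universal L T).unique
      ⟨fun a => (congrArg g (hf a)).trans (hg a), fun x => (congrArg g (hf1 x)).trans (hg1 x),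
        fun y => (congrArg g (hf2 y)).trans (hg2 y)⟩ ⟨fun _ => rfl, fun _ => rfl, fun _ => rfl⟩
  have hfg : f.comp g = ContinuousAlgHom.id ℂ L' :=
    (hT'.universal L' T').unique
      ⟨fun a => (congrArg f (hg a)).trans (hf a), fun x => (congrArg f (hg1 x)).trans (hf1 x),
        fun y => (congrArg f (hg2 y)).trans (hf2 y)⟩ ⟨fun _ => rfl, fun _ => rfl, fun _ => rfl⟩
  let e : L ≃A[ℂ] L' :=
    { AlgEquiv.ofAlgHom f.toAlgHom g.toAlgHom
        (AlgHom.ext fun x => congrArg (fun H => H x) hfg)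
        (AlgHom.ext fun x => congrArg (fun H => H x) hgf) with
      continuous_toFun := f.cont
      continuous_invFun := g.cont }
  refine ⟨e, ⟨hf, hf1 _, hf2 _⟩, ?_⟩
  rintro e' ⟨h, h1, h2⟩
  -- The conditions on `e'` concern only the images of `1`; left `A`-linearity of the bimodule maps
  -- extends them to all of `A_α` and `A_{α⁻¹}`, so the uniqueness of `f` applies.
  have he' : e'.toContinuousAlgHom = f := by
    refine hfu _ ⟨h, fun x => ?_, fun y => ?_⟩
    · obtain ⟨x, rfl⟩ := (Twist.of α).surjective x
      change e' _ = _
      rw [T.fst_of, T'.fst_of, map_mul, h, h1]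
    · obtain ⟨y, rfl⟩ := (Twist.of α.symm).surjective y
      change e' _ = _
      rw [T.snd_of, T'.snd_of, map_mul, h, h2]
  ext x
  exact congrArg (fun H => H x) he'

end Triples

end AMLaurent

theorem mainTheorem8 {A : Type u} [Ring A] [Algebra ℂ A] [UniformSpace A]
    [IsArensMichaelAlgebra A] (α : A ≃A[ℂ] A) (hα : IsMLocalizable (autPair α))
    {Λ : Type w} (p : SeminormFamily ℂ A Λ) (hp : WithSeminorms p) :
    -- the relations of `O(ℂ^×, A; α)`
    ((∀ a : A, TwistedLaurent.t α hα p hp * TwistedLaurent.incl α hα p hp a =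
        TwistedLaurent.incl α hα p hp (α a) * TwistedLaurent.t α hα p hp) ∧
      (∀ a : A, TwistedLaurent.tInv α hα p hp * TwistedLaurent.incl α hα p hp a =
        TwistedLaurent.incl α hα p hp (α.symm a) * TwistedLaurent.tInv α hα p hp) ∧
      TwistedLaurent.t α hα p hp * TwistedLaurent.tInv α hα p hp = 1 ∧
      TwistedLaurent.tInv α hα p hp * TwistedLaurent.t α hα p hp = 1) ∧
    -- `O(ℂ^×, A; α)` is an Arens-Michael algebra, and its natural triple is universal
    IsTopLaurentTensorAlgebra.{u, v, u} (TwistedLaurent.naturalTriple α hα p hp) ∧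
    -- every topological Laurent tensor algebra of `A_α` is isomorphic to `O(ℂ^×, A; α)`
    ∀ (L : Type u) [Ring L] [Algebra ℂ L] [UniformSpace L]
      (T : CompatibleTriple (twistPair α) L), IsTopLaurentTensorAlgebra.{u, u, u} T →
      ∃! e : L ≃A[ℂ] TwistedLaurent α hα p hp,
        (∀ a : A, e (T.θ a) = TwistedLaurent.incl α hα p hp a) ∧
        e (T.fst (Twist.of α 1)) = TwistedLaurent.t α hα p hp ∧
        e (T.snd (Twist.of α.symm 1)) = TwistedLaurent.tInv α hα p hp := by
  exact ⟨⟨TwistedLaurent.t_mul_incl hα p hp, TwistedLaurent.tInv_mul_incl hα p hp,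
    TwistedLaurent.t_mul_tInv hα p hp, TwistedLaurent.tInv_mul_t hα p hp⟩,
    TwistedLaurent.isTopLaurentTensorAlgebra hα p hp,
    fun L _ _ _ T hT => hT.existsUnique_equiv (TwistedLaurent.isTopLaurentTensorAlgebra hα p hp)⟩
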